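/- Let $A\ge 3$ and $2\le a\le A-1$ be integers, let $F\colon\{1,2,\dots\}\to(0,\infty)$ satisfy $\sum_{k\ge1}1/F(k)<\infty$, and let $x_0\ge 1$ be an integer. Let $(X(n))_{n\ge0}=((X_1(n),\dots,X_A(n)))_{n\ge0}$ be the generalized Pólya urn with $X_1(0)=\dots=X_A(0)=x_0$, i.e. the Markov chain on $\{1,2,\dots\}^A$ which jumps from $y$ to $y+e^{(i)}$ ($e^{(i)}$ the $i$-th unit vector) with probability $F(y_i)/\sum_{j=1}^A F(y_j)$. Put $X_i(\infty)=\lim_{n\to\infty}X_i(n)\in\{1,2,\dots\}\cup\{\infty\}$, let $sMon_i$ be the event that from some time on $X_j$ is constant for every $j\ne i$, let $L_a=sMon_1^c\cap\dots\cap sMon_a^c$, and let $\mathbb P_{A,a}=\mathbb P(\,\cdot\mid L_a)$. Let $\tau_i(k)$ ($1\le i\le A$, $k\ge x_0$) be independent, $\tau_i(k)$ exponentially distributed with parameter $F(k)$, and set $T_i=\sum_{k\ge x_0}\tau_i(k)$, $g(t)=\frac{d}{dt}\mathbb P(T_i\le t)$, $G(t)=\mathbb P(T_i>t)$, $S=\min_{a<i\le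 A}T_i$. Define the tail-dependence constant $$c(A,a)=\frac{\mathbb E\big[g(S)^a\big]}{\big(\mathbb E\big[G(S)^{a-1}g(S)\big]\big)^a}\;\mathbb P(L_a)^{a-1}.$$ Then $c(A,a)>1$, and for every integer $x\ge x_0$, $$\mathbb P_{A,a}\big(X_1(\infty)>x,\dots,X_a(\infty)>x\big)>\prod_{i=1}^a\mathbb P_{A,a}\big(X_i(\infty)>x\big).$$ -/

import Mathlib

open MeasureTheory ProbabilityTheory

noncomputable section

namespace PolyaUrn

/-- A feedback (rate) function with values in `(0, ∞)`.  Only its values at positive integers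
are used below, because all urns start with at least one ball of each colour. -/
abbrev Feedback : Type := ℕ → Set.Ioi (0 : ℝ)

/-- The explosion condition `∑_{k ≥ 1} 1 / F(k) < ∞`. -/
def Explosive (F : Feedback) : Prop :=
  Summable fun k : ℕ => 1 / (F (k + 1) : ℝ)

/-- The first `a` of the `A` colours. -/
def first (A a : ℕ) : Finset (Fin A) :=
  Finset.univ.filter fun i => (i : ℕ) < a

/-! ### The urn -/

section Urn

variable {A : ℕ} {Ω : Type*}

/-- `X` is a generalized Pólya urn process with feedback functions `F i` and initial
configuration `x₀`: it starts in `x₀` and, given the whole history up to time `n`, a ball of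
colour `i` is added with probability `F_i(X_i(n)) / ∑ j, F_j(X_j(n))`. -/
structure IsUrn [MeasurableSpace Ω] (F : Fin A → Feedback) (x₀ : Fin A → ℕ)
    (X : ℕ → Ω → Fin A → ℕ) (P : Measure Ω) : Prop where
  measurable : ∀ n, Measurable (X n)
  init : ∀ᵐ ω ∂P, X 0 ω = x₀
  step : ∀ (n : ℕ) (path : ℕ → Fin A → ℕ) (i : Fin A),
    P {ω | (∀ m ≤ n, X m ω = path m) ∧ X (n + 1) ω = path n + Pi.single i 1} =
      P {ω | ∀ m ≤ n, X m ω = path m} *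
        ENNReal.ofReal ((F i (path n i) : ℝ) / ∑ j, (F j (path n j) : ℝ))

/-- Strong monopoly of colour `i`: from some time on, no other colour is drawn. -/
def sMon (X : ℕ → Ω → Fin A → ℕ) (i : Fin A) : Set Ω :=
  {ω | ∃ N, ∀ n ≥ N, ∀ j ≠ i, X n ω j = X N ω j}

/-- None of the first `a` colours is the monopolist. -/
def losers (X : ℕ → Ω → Fin A → ℕ) (a : ℕ) : Set Ω :=
  {ω | ∀ i ∈ first A a, ω ∉ sMon X i}

/-- `X_i(∞) = lim_n X_i(n)`, with value `∞` allowed; the limit is a supremum because the number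
of balls of a colour never decreases. -/
def final (X : ℕ → Ω → Fin A → ℕ) (i : Fin A) (ω : Ω) : ℕ∞ :=
  ⨆ n, (X n ω i : ℕ∞)

/-- The probability measure `P` conditioned on the first `a` colours not being monopolist. -/
def condLosers [MeasurableSpace Ω] (P : Measure Ω) (X : ℕ → Ω → Fin A → ℕ) (a : ℕ) :
    Measure Ω :=
  ProbabilityTheory.cond P (losers X a)

end Urn

/-! ### Explosion times of independent birth processes -/

section Birth

variable {A : ℕ}

instance (r : Set.Ioi (0 : ℝ)) : IsProbabilityMeasure (expMeasure (r : ℝ)) :=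
  isProbabilityMeasure_expMeasure r.2

/-- The joint law of independent sojourn times `τ (i, k)`, exponential with rate `F_i(k)`. -/
def clockLaw (F : Fin A → Feedback) : Measure (Fin A × ℕ → ℝ) :=
  Measure.infinitePi fun p : Fin A × ℕ => expMeasure (F p.1 p.2 : ℝ)

/-- The explosion time `T_i = ∑_{k ≥ x₀ i} τ_i(k)`, in `[0, ∞]`, of the birth process with rate
function `F_i` started in `x₀ i`. -/
def explosionTime (x₀ : Fin A → ℕ) (i : Fin A) (τ : Fin A × ℕ → ℝ) : ENNReal :=
  ∑' k : Set.Ici (x₀ i), ENNReal.ofReal (τ (i, (k : ℕ)))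

/-- `g_i(t) = d/dt P(T_i ≤ t)`. -/
def density (F : Fin A → Feedback) (x₀ : Fin A → ℕ) (i : Fin A) (t : ℝ) : ℝ :=
  deriv (fun u : ℝ => (clockLaw F).real {τ | explosionTime x₀ i τ ≤ ENNReal.ofReal u}) t

/-- `G_i(t) = P(T_i > t)`. -/
def survival (F : Fin A → Feedback) (x₀ : Fin A → ℕ) (i : Fin A) (t : ℝ) : ℝ :=
  (clockLaw F).real {τ | ENNReal.ofReal t < explosionTime x₀ i τ}

/-- `S`, the minimum of the explosion times of all colours but the first `a`. -/
def minTime (x₀ : Fin A → ℕ) (a : ℕ) (τ : Fin A × ℕ → ℝ) : ℝ :=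
  (⨅ j : {j : Fin A // a ≤ (j : ℕ)}, explosionTime x₀ j τ).toReal

/-- The tail-dependence constant `c(A, a)` of the first `a` colours of an urn `X` with feedback
functions `F i` and initial configuration `x₀`. -/
def tailDependence {Ω : Type*} [MeasurableSpace Ω] (F : Fin A → Feedback) (x₀ : Fin A → ℕ)
    (P : Measure Ω) (X : ℕ → Ω → Fin A → ℕ) (a : ℕ) : ℝ :=
  (∫ τ, ∏ i ∈ first A a, density F x₀ i (minTime x₀ a τ) ∂clockLaw F) /
    (∏ i ∈ first A a,
      ∫ τ, (∏ j ∈ (first A a).erase i, survival F x₀ j (minTime x₀ a τ)) *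
        density F x₀ i (minTime x₀ a τ) ∂clockLaw F) *
    P.real (losers X a) ^ (a - 1)

end Birth

end PolyaUrn

end

namespace PolyaUrn
open Set Filter Topology
open scoped ENNReal

/-! ### Exponential laws -/

/-! The urn is realised as the jump chain of `A` independent birth processes (Rubin's exponential
embedding): colour `i` waits an exponential time of rate `F(k)` at level `k`, and the next ball
drawn is the one whose clock rings next. Memorylessness makes this an urn (`isUrn_embedded`), and
the transition probabilities determine the law of the path (`IsUrn.map_path_eq`), so every urn may
be replaced by the embedded one.

Almost surely all `T_i` are finite and distinct. The colour exploding first is the strong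
monopolist, and any other colour passes level `x` exactly when its ring at level `x` comes before
that explosion (`Generic.path`). Hence `L_a` is the event that `S < T_i` for the first `a` colours,
and on it `X_i(∞) > x` means that `τ_i(x₀) + ... + τ_i(x) ≤ S`. Given `S`, the first `a` rows of
clocks are i.i.d. With `μ` the law of `S` and `H(s)` the probability that the ring at level `x`
comes by time `s` and the explosion after it, this gives `P(L_a) = ∫ G^a dμ`, while one prescribed
loser passes `x` with probability `∫ H G^(a-1) dμ` and all of them with probability `∫ H^a dμ`, both
jointly with `L_a` (`Explosive.clockLaw_real_losers`, `IsUrn.real_losers_inter`).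

Both claims are now Hölder's inequality `(∫ h G^(a-1))^a < (∫ h^a) (∫ G^a)^(a-1)`, with `h = H` for
the probabilities and `h = g` for `c(A,a)`. It is strict because `h / G` is positive on `(0, ∞)` but
tends to `0` at `0`, and `S` charges every neighbourhood of `0`; so `h / G` is not `μ`-almost
everywhere constant (`strict_holder`). Strict positivity of `g` comes from the backward equation `g
= F(x₀) (P(T' ≤ t) - P(T ≤ t))`, where `T'` is the explosion time from level `x₀ + 1`. -/

lemma expMeasure_eq_withDensity (r : ℝ) :
    expMeasure r = volume.withDensity (exponentialPDF r) := rfl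

lemma measurable_exponentialPDF (r : ℝ) : Measurable (exponentialPDF r) :=
  (measurable_exponentialPDFReal r).ennreal_ofReal

lemma lintegral_expMeasure (r : ℝ) {f : ℝ → ℝ≥0∞} (hf : Measurable f) :
    ∫⁻ x, f x ∂expMeasure r = ∫⁻ x, exponentialPDF r x * f x := by
  rw [expMeasure_eq_withDensity,
    lintegral_withDensity_eq_lintegral_mul _ (measurable_exponentialPDF r) hf]
  rfl

instance (r : ℝ) : NullSingletonClass (expMeasure r) := by
  rw [expMeasure_eq_withDensity]; infer_instance

lemma expMeasure_Iio_zero (r : ℝ) : expMeasure r (Iio 0) = 0 := by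
  rw [expMeasure_eq_withDensity, withDensity_apply _ measurableSet_Iio]
  exact lintegral_exponentialPDF_of_nonpos le_rfl

lemma ae_pos_expMeasure (r : ℝ) : ∀ᵐ x ∂expMeasure r, 0 < x := by
  have h : expMeasure r (Iic 0) = 0 := by
    rw [← Iio_union_right]
    exact measure_union_null (expMeasure_Iio_zero r) (measure_singleton _)
  rw [ae_iff]
  convert h using 2
  ext; simp

/-- The density at `x + e` is `exp(-r e)` times the density at `x`, so a translation of Lebesgue
measure suffices. The proposition `c` records a tie-breaking rule at `x = e`; it costs nothing
because there are no atoms. -/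
lemma expMeasure_memoryless {r : ℝ} {e : ℝ} (he : 0 ≤ e) {B : Set ℝ}
    (hB : MeasurableSet B) (c : Prop) :
    expMeasure r {x | (e < x ∨ (e = x ∧ c)) ∧ x - e ∈ B} =
      ENNReal.ofReal (Real.exp (-(r * e))) * expMeasure r B := by
  have h1 : expMeasure r {x | (e < x ∨ (e = x ∧ c)) ∧ x - e ∈ B} =
      expMeasure r {x | e < x ∧ x - e ∈ B} := by
    refine measure_congr ?_
    filter_upwards [(measure_eq_zero_iff_ae_notMem.1 (measure_singleton (μ := expMeasure r) e))]
      with x hx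
    have : e ≠ x := fun h => hx (by simp [h])
    apply propext
    show ((e < x ∨ (e = x ∧ c)) ∧ x - e ∈ B) ↔ (e < x ∧ x - e ∈ B)
    simp [this]
  have h2 : expMeasure r B = expMeasure r (Ioi 0 ∩ B) := by
    refine measure_congr ?_
    filter_upwards [ae_pos_expMeasure r] with x hx
    apply propext
    show x ∈ B ↔ (0 < x ∧ x ∈ B)
    simp [hx]
  have m1 : MeasurableSet {x : ℝ | e < x ∧ x - e ∈ B} :=
    measurableSet_Ioi.inter ((measurable_id.sub_const e) hB)
  have m2 : MeasurableSet (Ioi (0 : ℝ) ∩ B) := measurableSet_Ioi.inter hB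
  rw [h1, h2, ← lintegral_indicator_one m1, ← lintegral_indicator_one m2,
    lintegral_expMeasure r (measurable_one.indicator m1),
    lintegral_expMeasure r (measurable_one.indicator m2),
    ← lintegral_const_mul (f := fun x => exponentialPDF r x * (Ioi (0 : ℝ) ∩ B).indicator 1 x) _
      ((measurable_exponentialPDF r).mul (measurable_one.indicator m2)),
    ← lintegral_add_right_eq_self _ e]
  refine lintegral_congr fun x => ?_
  by_cases hx : 0 < x ∧ x ∈ B
  · have a1 : x + e ∈ {x : ℝ | e < x ∧ x - e ∈ B} := by simpa using hx
    have a2 : x ∈ Ioi (0 : ℝ) ∩ B := hx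
    rw [indicator_of_mem a1, indicator_of_mem a2, Pi.one_apply, mul_one, Pi.one_apply, mul_one,
      exponentialPDF_of_nonneg (by linarith [hx.1]), exponentialPDF_of_nonneg hx.1.le,
      ← ENNReal.ofReal_mul (Real.exp_nonneg _)]
    congr 1
    rw [mul_left_comm, ← Real.exp_add]
    ring_nf
  · have a1 : x + e ∉ {x : ℝ | e < x ∧ x - e ∈ B} := by simpa using hx
    have a2 : x ∉ Ioi (0 : ℝ) ∩ B := hx
    rw [indicator_of_notMem a1, indicator_of_notMem a2]; simp

lemma expMeasure_Ioi {r : ℝ} (hr : 0 < r) {e : ℝ} (he : 0 ≤ e) :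
    expMeasure r (Ioi e) = ENNReal.ofReal (Real.exp (-(r * e))) := by
  have := isProbabilityMeasure_expMeasure hr
  have h := expMeasure_memoryless (r := r) he MeasurableSet.univ False
  simp only [and_false, or_false, mem_univ, and_true, measure_univ, mul_one] at h
  exact h

/-- With `s` the total rate of the competing clocks, this Laplace transform is the urn's transition
probability. -/
lemma lintegral_exp_neg_expMeasure {r s : ℝ} (hr : 0 < r) (hs : 0 ≤ s) :
    ∫⁻ x, ENNReal.ofReal (Real.exp (-(s * x))) ∂expMeasure r = ENNReal.ofReal (r / (r + s)) := by
  rw [lintegral_expMeasure r (by fun_prop)]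
  have hrs : 0 < r + s := by positivity
  rw [← mul_one (ENNReal.ofReal (r / (r + s))), ← lintegral_exponentialPDF_eq_one hrs,
    ← lintegral_const_mul _ (measurable_exponentialPDF _)]
  refine lintegral_congr fun x => ?_
  rcases lt_or_ge x 0 with hx | hx
  · simp [exponentialPDF_of_neg hx]
  · rw [exponentialPDF_of_nonneg hx, exponentialPDF_of_nonneg hx,
      ← ENNReal.ofReal_mul (by positivity), ← ENNReal.ofReal_mul (by positivity)]
    congr 1
    rw [mul_assoc, ← Real.exp_add, ← mul_assoc, div_mul_cancel₀ _ hrs.ne']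
    ring_nf

lemma lintegral_ofReal_expMeasure {r : ℝ} (hr : 0 < r) :
    ∫⁻ x, ENNReal.ofReal x ∂expMeasure r = ENNReal.ofReal (1 / r) := by
  have h0 : 0 ≤ᵐ[expMeasure r] fun x : ℝ => x := (ae_pos_expMeasure r).mono fun x hx => hx.le
  rw [lintegral_eq_lintegral_meas_lt _ h0 aemeasurable_id]
  have h1 : ∫⁻ t in Ioi (0 : ℝ), expMeasure r {a | t < a} =
      ∫⁻ t in Ioi (0 : ℝ), ENNReal.ofReal (1 / r) * exponentialPDF r t := by
    refine setLIntegral_congr_fun measurableSet_Ioi fun t ht => ?_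
    have ht' : (0 : ℝ) ≤ t := le_of_lt ht
    change expMeasure r (Ioi t) = _
    rw [expMeasure_Ioi hr ht', exponentialPDF_of_nonneg ht',
      ← ENNReal.ofReal_mul (by positivity)]
    congr 1
    field_simp
  rw [h1, lintegral_const_mul _ (measurable_exponentialPDF r),
    ← withDensity_apply _ measurableSet_Ioi, ← expMeasure_eq_withDensity,
    expMeasure_Ioi hr le_rfl]
  simp

/-! ### Memoryless property of a family of independent exponential clocks -/

section Clocks

variable {ι : Type*}

/-- The law of independent exponential clocks with rates `r`. -/
noncomputable def expFamily (r : ι → Ioi (0 : ℝ)) : Measure (ι → ℝ) :=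
  Measure.infinitePi fun p => expMeasure (r p : ℝ)

instance (r : ι → Ioi (0 : ℝ)) : IsProbabilityMeasure (expFamily r) := by
  unfold expFamily; infer_instance

lemma measurableSet_survives (J : Finset ι) (e : ℝ) (c : ι → Prop) :
    MeasurableSet {τ : ι → ℝ | ∀ q ∈ J, e < τ q ∨ (e = τ q ∧ c q)} := by
  have : {τ : ι → ℝ | ∀ q ∈ J, e < τ q ∨ (e = τ q ∧ c q)} =
      ⋂ q ∈ J, ({τ : ι → ℝ | e < τ q} ∪ ({τ : ι → ℝ | e = τ q} ∩ {_τ | c q})) := by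
    ext; simp
  rw [this]
  refine Finset.measurableSet_biInter _ fun q _ => ?_
  exact (measurableSet_lt measurable_const (measurable_pi_apply q)).union
    ((measurableSet_eq_fun measurable_const (measurable_pi_apply q)).inter (.const _))

variable [DecidableEq ι]

lemma measurable_update_uncurry (p : ι) :
    Measurable fun x : ℝ × (ι → ℝ) => Function.update x.2 p x.1 := by
  refine measurable_pi_lambda _ fun q => ?_
  by_cases h : q = p
  · subst h; simpa using measurable_fst
  · simp only [Function.update_of_ne h]; fun_prop

/-- This is how a single clock is integrated out by Fubini without splitting the index set: a
coordinate of a product law may be replaced by an independent copy. -/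
lemma expFamily_resample (r : ι → Ioi (0 : ℝ)) (p : ι) :
    ((expMeasure (r p : ℝ)).prod (expFamily r)).map (fun x => Function.update x.2 p x.1) =
      expFamily r := by
  have hm := measurable_update_uncurry p
  refine Measure.eq_infinitePi _ fun s t ht => ?_
  rw [Measure.map_apply hm (MeasurableSet.pi s.countable_toSet fun i _ => ht i)]
  by_cases hp : p ∈ s
  · have : (fun x : ℝ × (ι → ℝ) => Function.update x.2 p x.1) ⁻¹' (s : Set ι).pi t =
        t p ×ˢ ((s.erase p : Finset ι) : Set ι).pi t := by
      ext x
      simp only [mem_preimage, Set.mem_pi, mem_prod, Finset.mem_coe, Finset.mem_erase]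
      constructor
      · intro h
        refine ⟨by simpa using h p hp, fun i hi => ?_⟩
        simpa [Function.update_of_ne hi.1] using h i hi.2
      · rintro ⟨h1, h2⟩ i hi
        by_cases hip : i = p
        · subst hip; simpa using h1
        · simpa [Function.update_of_ne hip] using h2 i ⟨hip, hi⟩
    rw [this, Measure.prod_prod, expFamily, Measure.infinitePi_pi _ fun i _ => ht i,
      Finset.mul_prod_erase s (fun i => expMeasure (r i : ℝ) (t i)) hp]
  · have : (fun x : ℝ × (ι → ℝ) => Function.update x.2 p x.1) ⁻¹' (s : Set ι).pi t =
        univ ×ˢ (s : Set ι).pi t := by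
      ext x
      simp only [mem_preimage, Set.mem_pi, mem_prod, Finset.mem_coe, mem_univ, true_and]
      refine forall₂_congr fun i hi => ?_
      rw [Function.update_of_ne (ne_of_mem_of_not_mem hi hp)]
    rw [this, Measure.prod_prod, expFamily, Measure.infinitePi_pi _ fun i _ => ht i, measure_univ,
      one_mul]

/-- Subtract `e` from the coordinates in `J`. -/
def advance (J : Finset ι) (e : ℝ) (τ : ι → ℝ) (q : ι) : ℝ := if q ∈ J then τ q - e else τ q

lemma measurable_advance (J : Finset ι) (e : ℝ) : Measurable (advance J e) := by
  refine measurable_pi_lambda _ fun q => ?_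
  unfold advance
  split_ifs
  · exact Measurable.sub_const (measurable_pi_apply (X := fun _ : ι => ℝ) q) e
  · exact measurable_pi_apply (X := fun _ : ι => ℝ) q

/-- The law restricted to survival of all clocks in `J`, shifted by `e` and normalised, has the
right mass on every box by the one-clock statement; uniqueness of the product measure does the rest.
-/
lemma expFamily_memoryless (r : ι → Ioi (0 : ℝ)) (J : Finset ι) {e : ℝ} (he : 0 ≤ e)
    (c : ι → Prop) {E : Set (ι → ℝ)} (hE : MeasurableSet E) :
    expFamily r {τ | (∀ q ∈ J, e < τ q ∨ (e = τ q ∧ c q)) ∧ advance J e τ ∈ E} =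
      ENNReal.ofReal (Real.exp (-((∑ q ∈ J, (r q : ℝ)) * e))) * expFamily r E := by
  classical
  set D := {τ : ι → ℝ | ∀ q ∈ J, e < τ q ∨ (e = τ q ∧ c q)} with hD
  set k := ENNReal.ofReal (Real.exp (-((∑ q ∈ J, (r q : ℝ)) * e))) with hk
  have hD' : MeasurableSet D := measurableSet_survives J e c
  have hk0 : k ≠ 0 := by simp [hk, Real.exp_pos]
  have hkt : k ≠ ∞ := ENNReal.ofReal_ne_top
  have key : k⁻¹ • ((expFamily r).restrict D).map (advance J e) = expFamily r := by
    refine Measure.eq_infinitePi _ fun s t ht => ?_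
    have hpi : MeasurableSet ((s : Set ι).pi t) :=
      MeasurableSet.pi s.countable_toSet fun i _ => ht i
    rw [Measure.smul_apply, Measure.map_apply (measurable_advance J e) hpi,
      Measure.restrict_apply (measurable_advance J e hpi)]
    -- The box over `s` is extended to `s ∪ J` by trivial constraints, so that its preimage and the
    -- survival event together form one box `v`.
    let u : ι → Set ℝ := fun q => if q ∈ s then t q else univ
    let v : ι → Set ℝ := fun q =>
      if q ∈ J then {x | (e < x ∨ (e = x ∧ c q)) ∧ x - e ∈ u q} else u q
    have hu : ∀ q, MeasurableSet (u q) := fun q => by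
      by_cases h : q ∈ s <;> simp [u, h, ht]
    have hv : ∀ q, MeasurableSet (v q) := fun q => by
      by_cases h : q ∈ J
      · simp only [v, h, if_true]
        have : {x : ℝ | (e < x ∨ (e = x ∧ c q)) ∧ x - e ∈ u q} =
            (Ioi e ∪ ({e} ∩ {_x | c q})) ∩ (fun x => x - e) ⁻¹' u q := by
          ext x; simp [eq_comm]
        rw [this]
        exact (measurableSet_Ioi.union ((measurableSet_singleton e).inter (.const _))).inter
          ((measurable_id.sub_const e) (hu q))
      · simp [v, h, hu]
    have hset : advance J e ⁻¹' (s : Set ι).pi t ∩ D = ((s ∪ J : Finset ι) : Set ι).pi v := by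
      ext τ
      simp only [mem_inter_iff, mem_preimage, Set.mem_pi, Finset.mem_coe, hD, mem_ofPred_eq,
        Finset.mem_union, v, u, advance]
      constructor
      · rintro ⟨h1, h2⟩ q hq
        by_cases hJ : q ∈ J <;> by_cases hs : q ∈ s
        · simpa [hJ, hs] using ⟨h2 q hJ, by simpa [hJ] using h1 q hs⟩
        · simpa [hJ, hs] using h2 q hJ
        · simpa [hJ, hs] using h1 q hs
        · simp [hJ, hs]
      · intro h
        refine ⟨fun q hs => ?_, fun q hJ => ?_⟩
        · have := h q (Or.inl hs)
          by_cases hJ : q ∈ J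
          · simp only [hJ, hs, if_true] at this ⊢; exact this.2
          · simpa [hJ, hs] using this
        · have := h q (Or.inr hJ)
          simp only [hJ, if_true] at this; exact this.1
    have hval : ∀ q ∈ s ∪ J, expMeasure (r q : ℝ) (v q) =
        (if q ∈ J then ENNReal.ofReal (Real.exp (-(r q * e))) else 1) *
          (if q ∈ s then expMeasure (r q : ℝ) (t q) else 1) := by
      intro q _
      have hu' : expMeasure (r q : ℝ) (u q) =
          if q ∈ s then expMeasure (r q : ℝ) (t q) else 1 := by
        by_cases hs : q ∈ s <;> simp [u, hs]
      by_cases hJ : q ∈ J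
      · simp only [v, hJ, if_true]
        rw [expMeasure_memoryless he (hu q) (c q), hu']
      · simp only [v, hJ, if_false, one_mul, hu']
    rw [hset, expFamily, Measure.infinitePi_pi _ fun i _ => hv i, Finset.prod_congr rfl hval,
      Finset.prod_mul_distrib, Finset.prod_ite_mem, Finset.prod_ite_mem,
      Finset.inter_eq_right.2 Finset.subset_union_right,
      Finset.inter_eq_right.2 Finset.subset_union_left,
      ← ENNReal.ofReal_prod_of_nonneg fun i _ => Real.exp_nonneg _, ← Real.exp_sum]
    have : ∑ x ∈ J, -((r x : ℝ) * e) = -((∑ q ∈ J, (r q : ℝ)) * e) := by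
      rw [Finset.sum_neg_distrib, Finset.sum_mul]
    rw [this, smul_eq_mul, ← mul_assoc, ENNReal.inv_mul_cancel hk0 hkt, one_mul]
  have h := congrArg (fun μ : Measure (ι → ℝ) => μ E) key
  simp only [Measure.smul_apply, Measure.map_apply (measurable_advance J e) hE,
    Measure.restrict_apply (measurable_advance J e hE), smul_eq_mul] at h
  rw [← h, ← mul_assoc, ENNReal.mul_inv_cancel hk0 hkt, one_mul, inter_comm]
  rfl

/-- The first ring among independent exponential clocks: the probability that clock `p` rings
before those in `J`, jointly with an event for the clocks after the ring. -/
lemma expFamily_first_ring (r : ι → Ioi (0 : ℝ)) (p : ι) (J : Finset ι) (hpJ : p ∉ J)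
    (c : ι → Prop) {E : Set (ι → ℝ)} (hE : MeasurableSet E)
    (hEp : ∀ τ e, Function.update τ p e ∈ E ↔ τ ∈ E)
    (hmeas : MeasurableSet {τ : ι → ℝ |
      (∀ q ∈ J, τ p < τ q ∨ (τ p = τ q ∧ c q)) ∧ advance J (τ p) τ ∈ E}) :
    expFamily r {τ | (∀ q ∈ J, τ p < τ q ∨ (τ p = τ q ∧ c q)) ∧ advance J (τ p) τ ∈ E} =
      ENNReal.ofReal ((r p : ℝ) / (r p + ∑ q ∈ J, (r q : ℝ))) * expFamily r E := by
  have hm := measurable_update_uncurry p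
  -- After resampling, the ring time `e` of clock `p` is independent of the other clocks. For fixed
  -- `e` memorylessness gives the factor `exp(-e ∑ r_q)`, whose integral over `e` is the stated
  -- ratio of rates.
  conv_lhs => rw [← expFamily_resample r p]
  rw [Measure.map_apply hm hmeas, Measure.prod_apply (hm hmeas)]
  have hsum : 0 ≤ ∑ q ∈ J, (r q : ℝ) := Finset.sum_nonneg fun q _ => (r q).2.le
  rw [← lintegral_exp_neg_expMeasure (r p).2 hsum, ← lintegral_mul_const _ (by fun_prop)]
  refine lintegral_congr_ae ?_
  filter_upwards [ae_pos_expMeasure (r p : ℝ)] with e he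
  rw [← expFamily_memoryless r J he.le c hE]
  congr 1
  ext τ
  have hadv : advance J e (Function.update τ p e) = Function.update (advance J e τ) p e := by
    funext q
    by_cases hq : q = p
    · subst hq; simp [advance, hpJ]
    · simp [advance, Function.update_of_ne hq]
  simp only [mem_preimage, mem_ofPred_eq, Function.update_self, hadv, hEp]
  refine and_congr_left' (forall₂_congr fun q hq => ?_)
  rw [Function.update_of_ne (ne_of_mem_of_not_mem hq hpJ)]

end Clocks

/-! ### The urn embedded into independent exponential clocks -/

section Embedding

variable {A : ℕ}

lemma clockLaw_eq_expFamily (F : Fin A → Feedback) :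
    clockLaw F = expFamily fun p : Fin A × ℕ => F p.1 p.2 := rfl

instance (F : Fin A → Feedback) : IsProbabilityMeasure (clockLaw F) := by
  rw [clockLaw_eq_expFamily]; infer_instance

/-- Colour `i` rings first, ties being resolved by the order of the colours. -/
def RingsFirst (v : Fin A → ℝ) (i : Fin A) : Prop :=
  ∀ j, j ≠ i → v i < v j ∨ (v i = v j ∧ i < j)

lemma RingsFirst.le {v : Fin A → ℝ} {i : Fin A} (h : RingsFirst v i) (j : Fin A) : v i ≤ v j := by
  by_cases hj : j = i
  · rw [hj]
  · rcases h j hj with h | h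
    exacts [h.le, h.1.le]

lemma RingsFirst.unique {v : Fin A → ℝ} {i j : Fin A} (hi : RingsFirst v i)
    (hj : RingsFirst v j) : i = j := by
  by_contra hne
  rcases hi j (Ne.symm hne) with h | h <;> rcases hj i hne with h' | h'
  · exact lt_asymm h h'
  · exact h.ne' h'.1
  · exact h'.ne' h.1
  · exact lt_asymm h.2 h'.2

lemma exists_ringsFirst [NeZero A] (v : Fin A → ℝ) : ∃ i, RingsFirst v i := by
  -- The lexicographic minimum implements the tie-breaking by colour.
  obtain ⟨i, hi⟩ := Finite.exists_min fun j => toLex (v j, j)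
  refine ⟨i, fun j hj => ?_⟩
  have := (Prod.Lex.toLex_le_toLex).1 (hi j)
  rcases this with h | h
  · exact Or.inl h
  · exact Or.inr ⟨h.1, lt_of_le_of_ne h.2 (Ne.symm hj)⟩

/-- The colour that rings first. -/
noncomputable def earliest [NeZero A] (v : Fin A → ℝ) : Fin A := (exists_ringsFirst v).choose

lemma ringsFirst_earliest [NeZero A] (v : Fin A → ℝ) : RingsFirst v (earliest v) :=
  (exists_ringsFirst v).choose_spec

lemma earliest_eq_iff [NeZero A] {v : Fin A → ℝ} {i : Fin A} :
    earliest v = i ↔ RingsFirst v i :=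
  ⟨fun h => h ▸ ringsFirst_earliest v, fun h => (ringsFirst_earliest v).unique h⟩

lemma measurable_earliest [NeZero A] : Measurable (earliest (A := A)) := by
  refine measurable_to_countable' fun i => ?_
  have : earliest ⁻¹' {i} = ⋂ j : Fin A,
      {v : Fin A → ℝ | j ≠ i → v i < v j ∨ (v i = v j ∧ i < j)} := by
    ext v
    simp only [mem_preimage, mem_singleton_iff, earliest_eq_iff, RingsFirst, mem_iInter,
      mem_ofPred_eq]
  rw [this]
  refine MeasurableSet.iInter fun j => ?_
  by_cases hj : j = i
  · simp [hj]
  · simp only [ne_eq, hj, not_false_eq_true, forall_true_left]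
    exact (measurableSet_lt (measurable_pi_apply i) (measurable_pi_apply j)).union
      ((measurableSet_eq_fun (measurable_pi_apply i) (measurable_pi_apply j)).inter (.const _))

/-- The current clocks of all colours but `i` in the configuration `y`. -/
def otherClocks (y : Fin A → ℕ) (i : Fin A) : Finset (Fin A × ℕ) :=
  (Finset.univ.erase i).map ⟨fun j => (j, y j), fun _ _ h => (Prod.ext_iff.1 h).1⟩

lemma mem_otherClocks {y : Fin A → ℕ} {i j : Fin A} {k : ℕ} :
    (j, k) ∈ otherClocks y i ↔ j ≠ i ∧ k = y j := by
  simp only [otherClocks, Finset.mem_map, Finset.mem_erase, Finset.mem_univ, and_true]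
  constructor
  · rintro ⟨l, hl, h⟩
    obtain ⟨rfl, rfl⟩ := Prod.mk.inj h
    exact ⟨hl, rfl⟩
  · rintro ⟨h, rfl⟩; exact ⟨j, h, rfl⟩

/-- The clocks after colour `i` has rung in the configuration `y`. -/
def afterRing (y : Fin A → ℕ) (i : Fin A) (τ : Fin A × ℕ → ℝ) : Fin A × ℕ → ℝ :=
  advance (otherClocks y i) (τ (i, y i)) τ

lemma afterRing_apply (y : Fin A → ℕ) (i : Fin A) (τ : Fin A × ℕ → ℝ) (j : Fin A) (k : ℕ) :
    afterRing y i τ (j, k) = if j ≠ i ∧ k = y j then τ (j, k) - τ (i, y i) else τ (j, k) := by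
  simp only [afterRing, advance, mem_otherClocks]

lemma measurable_afterRing (y : Fin A → ℕ) (i : Fin A) : Measurable (afterRing y i) := by
  refine measurable_pi_lambda _ fun q => ?_
  obtain ⟨j, k⟩ := q
  simp only [afterRing_apply]
  split_ifs <;> fun_prop

lemma single_one_injective {i j : Fin A} {y : Fin A → ℕ}
    (h : y + Pi.single i 1 = y + Pi.single j 1) : i = j := by
  have := congrFun (add_left_cancel h) i
  by_contra hij
  simp [Pi.single_eq_of_ne hij] at this

variable [NeZero A]

/-- The urn driven by the clocks `τ`, started in `y`. -/
noncomputable def embedded : ℕ → (Fin A → ℕ) → (Fin A × ℕ → ℝ) → Fin A → ℕ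
  | 0, y, _ => y
  | n + 1, y, τ =>
    embedded n (y + Pi.single (earliest fun j => τ (j, y j)) 1)
      (afterRing y (earliest fun j => τ (j, y j)) τ)

lemma embedded_zero (y : Fin A → ℕ) (τ : Fin A × ℕ → ℝ) : embedded 0 y τ = y := rfl

lemma embedded_succ {n : ℕ} {y : Fin A → ℕ} {τ : Fin A × ℕ → ℝ} {i : Fin A}
    (h : RingsFirst (fun j => τ (j, y j)) i) :
    embedded (n + 1) y τ = embedded n (y + Pi.single i 1) (afterRing y i τ) := by
  rw [embedded, earliest_eq_iff.2 h]

/-- Levels never decrease, so clocks below the current configuration are never consulted. In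
particular the clock that has just rung is irrelevant for the future. -/
lemma embedded_congr (n : ℕ) {y : Fin A → ℕ} {τ τ' : Fin A × ℕ → ℝ}
    (h : ∀ j k, y j ≤ k → τ (j, k) = τ' (j, k)) : embedded n y τ = embedded n y τ' := by
  induction n generalizing y τ τ' with
  | zero => rfl
  | succ n ih =>
    have h1 : (fun j => τ (j, y j)) = fun j => τ' (j, y j) := funext fun j => h j _ le_rfl
    rw [embedded, embedded, h1]
    refine ih fun j k hk => ?_
    have hk' : y j ≤ k := le_trans (by simp) hk
    rw [afterRing_apply, afterRing_apply, h j k hk', h _ _ le_rfl]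

lemma measurable_embedded (n : ℕ) (y : Fin A → ℕ) : Measurable (embedded n y) := by
  induction n generalizing y with
  | zero => exact measurable_const
  | succ n ih =>
    have h1 : Measurable fun p : Fin A × (Fin A × ℕ → ℝ) =>
        embedded n (y + Pi.single p.1 1) (afterRing y p.1 p.2) :=
      measurable_from_prod_countable_right fun i =>
        (ih (y + Pi.single i 1)).comp (measurable_afterRing y i)
    have h2 : Measurable fun τ : Fin A × ℕ → ℝ => earliest fun j => τ (j, y j) :=
      measurable_earliest.comp (by fun_prop)
    exact h1.comp (h2.prodMk measurable_id)

/-- Strong Markov property at the first draw. -/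
lemma clockLaw_first_draw (F : Fin A → Feedback) (y : Fin A → ℕ) (i : Fin A)
    {W : Set (ℕ → Fin A → ℕ)} (hW : MeasurableSet W) :
    clockLaw F {τ | RingsFirst (fun j => τ (j, y j)) i ∧
        (fun n => embedded n (y + Pi.single i 1) (afterRing y i τ)) ∈ W} =
      ENNReal.ofReal ((F i (y i) : ℝ) / ∑ j, (F j (y j) : ℝ)) *
        clockLaw F {τ | (fun n => embedded n (y + Pi.single i 1) τ) ∈ W} := by
  have hpath : Measurable fun τ : Fin A × ℕ → ℝ => fun n => embedded n (y + Pi.single i 1) τ :=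
    measurable_pi_lambda _ fun n => measurable_embedded n _
  have hset : {τ : Fin A × ℕ → ℝ | RingsFirst (fun j => τ (j, y j)) i ∧
        (fun n => embedded n (y + Pi.single i 1) (afterRing y i τ)) ∈ W} =
      {τ | (∀ q ∈ otherClocks y i, τ (i, y i) < τ q ∨ (τ (i, y i) = τ q ∧ i < q.1)) ∧
        advance (otherClocks y i) (τ (i, y i)) τ ∈
          {τ | (fun n => embedded n (y + Pi.single i 1) τ) ∈ W}} := by
    ext τ
    simp only [mem_ofPred_eq, RingsFirst, afterRing, Prod.forall, mem_otherClocks, and_imp]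
    refine and_congr_left' ⟨fun h j k hj hk => hk ▸ h j hj, fun h j hj => h j _ hj rfl⟩
  have hms : MeasurableSet {τ : Fin A × ℕ → ℝ | RingsFirst (fun j => τ (j, y j)) i ∧
        (fun n => embedded n (y + Pi.single i 1) (afterRing y i τ)) ∈ W} := by
    have e1 : MeasurableSet {τ : Fin A × ℕ → ℝ | RingsFirst (fun j => τ (j, y j)) i} := by
      have hm : Measurable fun τ : Fin A × ℕ → ℝ => earliest fun j => τ (j, y j) :=
        measurable_earliest.comp (by fun_prop)
      have := hm (measurableSet_singleton i)
      simpa only [preimage, mem_singleton_iff, earliest_eq_iff] using this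
    exact e1.inter ((hpath.comp (measurable_afterRing y i)) hW)
  rw [hset] at hms ⊢
  rw [clockLaw_eq_expFamily,
    expFamily_first_ring (E := {τ | (fun n => embedded n (y + Pi.single i 1) τ) ∈ W}) _
      (i, y i) (otherClocks y i) (by simp [mem_otherClocks])
      (fun q => i < q.1) (hpath hW) ?_ hms]
  · congr 3
    rw [otherClocks, Finset.sum_map]
    exact Finset.add_sum_erase Finset.univ (fun j => (F j (y j) : ℝ)) (Finset.mem_univ i)
  · intro τ e
    simp only [mem_ofPred_eq]
    have : (fun n => embedded n (y + Pi.single i 1) (Function.update τ (i, y i) e)) =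
        fun n => embedded n (y + Pi.single i 1) τ := by
      funext n
      refine embedded_congr n fun j k hk => Function.update_of_ne ?_ _ _
      -- The future starts from level `y i + 1` of colour `i`, strictly above the clock being
      -- altered.
      rintro h
      obtain ⟨rfl, rfl⟩ := Prod.mk.inj h
      simp at hk
    rw [this]

/-- The embedded process is an urn. -/
theorem isUrn_embedded (F : Fin A → Feedback) (x₀ : Fin A → ℕ) :
    IsUrn F x₀ (fun n => embedded n x₀) (clockLaw F) where
  measurable n := measurable_embedded n x₀
  init := ae_of_all _ fun _ => rfl
  step := by
    intro n
    induction n generalizing x₀ with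
    | zero =>
      intro path i
      by_cases h0 : x₀ = path 0
      · have h := clockLaw_first_draw F x₀ i MeasurableSet.univ
        simp only [mem_univ, and_true, measure_univ, mul_one, ofPred_true] at h
        have e1 : {τ : Fin A × ℕ → ℝ | (∀ m ≤ 0, embedded m x₀ τ = path m) ∧
            embedded (0 + 1) x₀ τ = path 0 + Pi.single i 1} =
            {τ | RingsFirst (fun j => τ (j, x₀ j)) i} := by
          ext τ
          simp only [nonpos_iff_eq_zero, forall_eq, mem_ofPred_eq, embedded_zero, h0, true_and]
          rw [← h0, embedded, embedded_zero, ← earliest_eq_iff]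
          exact ⟨single_one_injective, fun h => by rw [h]⟩
        have e2 : {τ : Fin A × ℕ → ℝ | ∀ m ≤ 0, embedded m x₀ τ = path m} = univ := by
          ext τ; simp [embedded_zero, h0]
        rw [e1, e2, h, ← h0, measure_univ, one_mul]
      · simp [embedded_zero, h0]
    | succ n ih =>
      intro path i
      by_cases h0 : x₀ = path 0
      -- The induction removes the first draw rather than the last: by the strong Markov property
      -- both sides acquire the same first-step factor, and the shifted path is handled by the
      -- induction hypothesis from the new initial configuration. A path with an inadmissible first
      -- step has probability zero on both sides.
      · by_cases h1 : ∃ j, path 1 = x₀ + Pi.single j 1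
        · obtain ⟨j, hj⟩ := h1
          have key : ∀ V : Set (ℕ → Fin A → ℕ),
              {τ : Fin A × ℕ → ℝ | (∀ m ≤ n + 1, embedded m x₀ τ = path m) ∧
                (fun m => embedded (m + 1) x₀ τ) ∈ V} =
              {τ | RingsFirst (fun j => τ (j, x₀ j)) j ∧
                (fun n => embedded n (x₀ + Pi.single j 1) (afterRing x₀ j τ)) ∈
                  {w | ∀ m ≤ n, w m = path (m + 1)} ∩ V} := by
            intro V
            ext τ
            simp only [mem_ofPred_eq, mem_inter_iff]
            constructor
            · rintro ⟨h, hV⟩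
              have hr : RingsFirst (fun j => τ (j, x₀ j)) j := by
                have := h 1 (by omega)
                rw [embedded, embedded_zero, hj] at this
                exact earliest_eq_iff.1 (single_one_injective this)
              simp only [embedded_succ hr] at hV
              refine ⟨hr, fun m hm => ?_, hV⟩
              rw [← embedded_succ hr, h _ (by omega)]
            · rintro ⟨hr, h, hV⟩
              simp only [← embedded_succ hr] at hV h
              refine ⟨fun m hm => ?_, hV⟩
              cases m with
              | zero => rw [embedded_zero, h0]
              | succ m => exact h m (by omega)
          have mW : MeasurableSet {w : ℕ → Fin A → ℕ | ∀ m ≤ n, w m = path (m + 1)} := by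
            have : {w : ℕ → Fin A → ℕ | ∀ m ≤ n, w m = path (m + 1)} =
                ⋂ m ∈ Finset.range (n + 1), (fun w : ℕ → Fin A → ℕ => w m) ⁻¹' {path (m + 1)} := by
              ext; simp
            rw [this]
            exact Finset.measurableSet_biInter _ fun m _ =>
              measurable_pi_apply m (measurableSet_singleton _)
          have mV : MeasurableSet {w : ℕ → Fin A → ℕ | w (n + 1) = path (n + 1) + Pi.single i 1} :=
            measurable_pi_apply (n + 1) (measurableSet_singleton _)
          have k1 := key {w | w (n + 1) = path (n + 1) + Pi.single i 1}
          have k2 := key univ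
          simp only [mem_ofPred_eq, mem_univ, and_true] at k1 k2
          rw [k1, k2, clockLaw_first_draw F x₀ j (mW.inter mV),
            clockLaw_first_draw F x₀ j (mW.inter .univ)]
          have hi := ih (x₀ + Pi.single j 1) (fun m => path (m + 1)) i
          simp only [mem_inter_iff, mem_ofPred_eq, mem_univ, and_true]
          rw [hi, mul_assoc]
        · have hz : ∀ p : (Fin A × ℕ → ℝ) → Prop, {τ : Fin A × ℕ → ℝ |
              (∀ m ≤ n + 1, embedded m x₀ τ = path m) ∧ p τ} = ∅ := by
            intro p
            ext τ
            simp only [mem_ofPred_eq, mem_empty_iff_false, iff_false, not_and]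
            intro h _
            refine h1 ⟨earliest fun j => τ (j, x₀ j), ?_⟩
            rw [← h 1 (by omega), embedded, embedded_zero]
          have h2 := hz fun _ => True
          simp only [and_true] at h2
          rw [hz, h2]; simp
      · have hz : ∀ p : (Fin A × ℕ → ℝ) → Prop, {τ : Fin A × ℕ → ℝ |
            (∀ m ≤ n + 1, embedded m x₀ τ = path m) ∧ p τ} = ∅ := by
          intro p
          ext τ
          simp only [mem_ofPred_eq, mem_empty_iff_false, iff_false, not_and]
          intro h _
          exact h0 (h 0 (by omega))
        have h2 := hz fun _ => True
        simp only [and_true] at h2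
        rw [hz, h2]; simp

end Embedding

/-! ### The law of an urn is determined by its transition probabilities -/

section Law

/-- Probability measures on a space of sequences in a countable discrete space agree if they agree
on all initial segments. -/
lemma measure_path_ext {α : Type*} [Countable α] [MeasurableSpace α] [MeasurableSingletonClass α]
    {μ ν : Measure (ℕ → α)} [IsFiniteMeasure μ] [IsFiniteMeasure ν]
    (h : ∀ (n : ℕ) (path : ℕ → α), μ {w | ∀ m ≤ n, w m = path m} =
      ν {w | ∀ m ≤ n, w m = path m}) : μ = ν := by
  rcases isEmpty_or_nonempty α with hα | ⟨⟨a⟩⟩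
  · exact Measure.ext fun s _ => by simp [Set.eq_empty_of_isEmpty s]
  have hI : ∀ n : ℕ, μ.map (Finset.Iic n).restrict = ν.map (Finset.Iic n).restrict := by
    intro n
    refine Measure.ext_of_singleton fun v => ?_
    rw [Measure.map_apply (Finset.measurable_restrict _) (measurableSet_singleton _),
      Measure.map_apply (Finset.measurable_restrict _) (measurableSet_singleton _)]
    have : ((Finset.Iic n).restrict : (ℕ → α) → _) ⁻¹' {v} = {w : ℕ → α | ∀ m ≤ n, w m =
        (fun m => if hm : m ∈ Finset.Iic n then v ⟨m, hm⟩ else a) m} := by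
      ext w
      simp only [mem_preimage, mem_singleton_iff, funext_iff, Subtype.forall, Finset.restrict,
        Finset.mem_Iic, mem_ofPred_eq]
      exact forall₂_congr fun m hm => by simp [hm]
    rw [this]
    exact h n _
  -- Initial segments are cofinal among finite index sets, so both measures are projective limits of
  -- the same family and coincide.
  have h1 : IsProjectiveLimit μ fun I => μ.map I.restrict := fun I => rfl
  have h2 : IsProjectiveLimit ν fun I => μ.map I.restrict := by
    intro I
    have hsub : I ⊆ Finset.Iic (I.sup id) := fun i hi =>
      Finset.mem_Iic.2 (Finset.le_sup (f := id) hi)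
    have hc : (I.restrict : (ℕ → α) → _) =
        Finset.restrict₂ hsub ∘ (Finset.Iic (I.sup id)).restrict := rfl
    change ν.map I.restrict = μ.map I.restrict
    rw [hc, ← Measure.map_map (Finset.measurable_restrict₂ _) (Finset.measurable_restrict _),
      ← Measure.map_map (Finset.measurable_restrict₂ _) (Finset.measurable_restrict _), hI]
  exact h1.unique h2

variable {A : ℕ} {Ω : Type*} [MeasurableSpace Ω]
  {F : Fin A → Feedback} {x₀ : Fin A → ℕ} {X : ℕ → Ω → Fin A → ℕ} {P : Measure Ω}

lemma IsUrn.measurable_path (hX : IsUrn F x₀ X P) : Measurable fun ω n => X n ω :=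
  measurable_pi_lambda _ hX.measurable

lemma IsUrn.measurableSet_history (hX : IsUrn F x₀ X P) (n : ℕ) (path : ℕ → Fin A → ℕ) :
    MeasurableSet {ω | ∀ m ≤ n, X m ω = path m} := by
  have : {ω | ∀ m ≤ n, X m ω = path m} = ⋂ m ∈ Finset.range (n + 1), X m ⁻¹' {path m} := by
    ext; simp
  rw [this]
  exact Finset.measurableSet_biInter _ fun m _ => hX.measurable m (measurableSet_singleton _)

variable [NeZero A]

lemma sum_rates_pos (F : Fin A → Feedback) (y : Fin A → ℕ) : 0 < ∑ j, (F j (y j) : ℝ) :=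
  Finset.sum_pos (fun j _ => (F j (y j)).2) ⟨0, Finset.mem_univ _⟩

/-- `IsUrn` prescribes only the probabilities of unit increments; since these sum to one, nothing is
left for any other step. -/
lemma IsUrn.measure_inadmissible [IsFiniteMeasure P] (hX : IsUrn F x₀ X P) (n : ℕ)
    (path : ℕ → Fin A → ℕ) :
    P {ω | (∀ m ≤ n, X m ω = path m) ∧ ∀ i, X (n + 1) ω ≠ path n + Pi.single i 1} = 0 := by
  set H := {ω | ∀ m ≤ n, X m ω = path m} with hH
  set D : Fin A → Set Ω := fun i => {ω | (∀ m ≤ n, X m ω = path m) ∧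
    X (n + 1) ω = path n + Pi.single i 1} with hD
  have mH : MeasurableSet H := hX.measurableSet_history n path
  have mD : ∀ i, MeasurableSet (D i) := fun i =>
    mH.inter (hX.measurable (n + 1) (measurableSet_singleton _))
  have hdisj : Pairwise (Function.onFun Disjoint D) := by
    intro i j hij
    refine Set.disjoint_left.2 fun ω hi hj => hij ?_
    exact single_one_injective (hi.2.symm.trans hj.2)
  have hU : P (⋃ i, D i) = P H := by
    rw [measure_iUnion hdisj mD, tsum_fintype]
    have : ∀ i, P (D i) = P H * ENNReal.ofReal ((F i (path n i) : ℝ) / ∑ j, (F j (path n j) : ℝ)) :=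
      fun i => hX.step n path i
    have hs := sum_rates_pos F (path n)
    simp_rw [this]
    rw [← Finset.mul_sum, ← ENNReal.ofReal_sum_of_nonneg
      (fun i _ => div_nonneg (F i (path n i)).2.le hs.le), ← Finset.sum_div, div_self hs.ne',
      ENNReal.ofReal_one, mul_one]
  have hsub : (⋃ i, D i) ⊆ H := iUnion_subset fun i ω h => h.1
  have : {ω | (∀ m ≤ n, X m ω = path m) ∧ ∀ i, X (n + 1) ω ≠ path n + Pi.single i 1} =
      H \ ⋃ i, D i := by
    ext ω
    simp only [hH, hD, mem_ofPred_eq, Set.mem_sdiff, mem_iUnion, not_exists, not_and]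
    exact ⟨fun h => ⟨h.1, fun i _ => h.2 i⟩, fun h => ⟨h.1, fun i => h.2 i h.1⟩⟩
  rw [this, measure_sdiff hsub (MeasurableSet.iUnion mD).nullMeasurableSet (measure_ne_top _ _), hU,
    tsub_self]

variable {Ω' : Type*} [MeasurableSpace Ω'] {Y : ℕ → Ω' → Fin A → ℕ} {Q : Measure Ω'}

lemma IsUrn.measure_history_eq [IsProbabilityMeasure P] [IsProbabilityMeasure Q]
    (hX : IsUrn F x₀ X P) (hY : IsUrn F x₀ Y Q) (n : ℕ) (path : ℕ → Fin A → ℕ) :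
    P {ω | ∀ m ≤ n, X m ω = path m} = Q {ω | ∀ m ≤ n, Y m ω = path m} := by
  induction n with
  | zero =>
    simp only [nonpos_iff_eq_zero, forall_eq]
    by_cases h : x₀ = path 0
    · have h1 : {ω | X 0 ω = path 0} =ᵐ[P] univ := by
        filter_upwards [hX.init] with ω hω
        exact propext ⟨fun _ => trivial, fun _ => hω.trans h⟩
      have h2 : {ω | Y 0 ω = path 0} =ᵐ[Q] univ := by
        filter_upwards [hY.init] with ω hω
        exact propext ⟨fun _ => trivial, fun _ => hω.trans h⟩
      rw [measure_congr h1, measure_congr h2, measure_univ, measure_univ]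
    · have h1 : {ω | X 0 ω = path 0} =ᵐ[P] (∅ : Set Ω) := by
        filter_upwards [hX.init] with ω hω
        exact propext ⟨fun hp => h (hω.symm.trans hp), False.elim⟩
      have h2 : {ω | Y 0 ω = path 0} =ᵐ[Q] (∅ : Set Ω') := by
        filter_upwards [hY.init] with ω hω
        exact propext ⟨fun hp => h (hω.symm.trans hp), False.elim⟩
      rw [measure_congr h1, measure_congr h2, measure_empty, measure_empty]
  | succ n ih =>
    by_cases h : ∃ i, path (n + 1) = path n + Pi.single i 1
    · obtain ⟨i, hi⟩ := h
      have e1 : {ω | ∀ m ≤ n + 1, X m ω = path m} =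
          {ω | (∀ m ≤ n, X m ω = path m) ∧ X (n + 1) ω = path n + Pi.single i 1} := by
        ext ω; simp only [mem_ofPred_eq, Nat.le_succ_iff, or_imp, forall_and, forall_eq, hi]
      have e2 : {ω | ∀ m ≤ n + 1, Y m ω = path m} =
          {ω | (∀ m ≤ n, Y m ω = path m) ∧ Y (n + 1) ω = path n + Pi.single i 1} := by
        ext ω; simp only [mem_ofPred_eq, Nat.le_succ_iff, or_imp, forall_and, forall_eq, hi]
      rw [e1, e2, hX.step, hY.step, ih]
    · push Not at h
      rw [measure_mono_null _ (hX.measure_inadmissible n path),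
        measure_mono_null _ (hY.measure_inadmissible n path)]
      · exact fun ω hω => ⟨fun m hm => hω m (by omega), fun i => by rw [hω _ le_rfl]; exact h i⟩
      · exact fun ω hω => ⟨fun m hm => hω m (by omega), fun i => by rw [hω _ le_rfl]; exact h i⟩

/-- The law of the path of an urn is determined by the feedback and the initial configuration. -/
theorem IsUrn.map_path_eq [IsProbabilityMeasure P] [IsProbabilityMeasure Q]
    (hX : IsUrn F x₀ X P) (hY : IsUrn F x₀ Y Q) :
    P.map (fun ω n => X n ω) = Q.map (fun ω n => Y n ω) := by
  have := Measure.isProbabilityMeasure_map (μ := P) hX.measurable_path.aemeasurable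
  have := Measure.isProbabilityMeasure_map (μ := Q) hY.measurable_path.aemeasurable
  refine measure_path_ext fun n path => ?_
  have mW : MeasurableSet {w : ℕ → Fin A → ℕ | ∀ m ≤ n, w m = path m} := by
    have : {w : ℕ → Fin A → ℕ | ∀ m ≤ n, w m = path m} =
        ⋂ m ∈ Finset.range (n + 1), (fun w : ℕ → Fin A → ℕ => w m) ⁻¹' {path m} := by
      ext; simp
    rw [this]
    exact Finset.measurableSet_biInter _ fun m _ =>
      measurable_pi_apply m (measurableSet_singleton _)
  rw [Measure.map_apply hX.measurable_path mW, Measure.map_apply hY.measurable_path mW]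
  exact hX.measure_history_eq hY n path

end Law

/-! ### Paths that always draw the colour with the smallest next ring time -/

section Greedy

variable {A : ℕ}

/-- The path `w` draws at each step a colour whose next ring time is minimal. -/
def Greedy (s : Fin A → ℕ → ℝ) (w : ℕ → Fin A → ℕ) : Prop :=
  ∀ n, ∃ i, w (n + 1) = w n + Pi.single i 1 ∧ ∀ j, s i (w n i) ≤ s j (w n j)

variable {s : Fin A → ℕ → ℝ} {w : ℕ → Fin A → ℕ}

lemma Greedy.monotone (h : Greedy s w) (j : Fin A) : Monotone fun n => w n j := by
  refine monotone_nat_of_le_succ fun n => ?_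
  obtain ⟨i, hi, -⟩ := h n
  simp [hi]

lemma Greedy.sum_eq (h : Greedy s w) (n : ℕ) : ∑ j, w n j = ∑ j, w 0 j + n := by
  induction n with
  | zero => rfl
  | succ n ih =>
    obtain ⟨i, hi, -⟩ := h n
    simp [hi, Finset.sum_add_distrib, ih, add_assoc]

/-- If colour `j` passes the level `k`, it was drawn at level `k`. -/
lemma Greedy.exists_draw (h : Greedy s w) {j : Fin A} {k n : ℕ} (h0 : w 0 j ≤ k)
    (hn : k < w n j) : ∃ m, w m j = k ∧ ∀ l, s j k ≤ s l (w m l) := by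
  induction n with
  | zero => omega
  | succ n ih =>
    by_cases hk : k < w n j
    · exact ih hk
    · obtain ⟨i, hi, hs⟩ := h n
      have hij : i = j := by
        by_contra hij
        rw [hi] at hn
        simp [Pi.single_eq_of_ne (Ne.symm hij)] at hn
        exact hk hn
      subst hij
      have : w n i = k := by
        rw [hi] at hn
        simp at hn
        omega
      exact ⟨n, this, fun l => this ▸ hs l⟩

variable {i₀ : Fin A} {T : ℝ}

/-- To pass level `K`, colour `j` would have to be drawn there, although the next ring of `i₀`
always comes before `T`, hence earlier than `s j K`. -/
lemma Greedy.bounded (h : Greedy s w) (hlt : ∀ k ≥ w 0 i₀, s i₀ k < T) {j : Fin A} {K : ℕ}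
    (hK : w 0 j ≤ K) (hKT : T ≤ s j K) (n : ℕ) : w n j ≤ K := by
  by_contra! hn
  obtain ⟨m, -, hm⟩ := h.exists_draw hK hn
  have := hm i₀
  have h2 := hlt (w m i₀) (h.monotone i₀ (Nat.zero_le m))
  linarith

lemma Greedy.unbounded (h : Greedy s w) (hlt : ∀ k ≥ w 0 i₀, s i₀ k < T)
    (hoth : ∀ j ≠ i₀, ∃ K ≥ w 0 j, T < s j K) (k : ℕ) : ∃ n, k < w n i₀ := by
  classical
  choose! K hK hKT using hoth
  -- One ball is added per step and the other colours hold at most `∑ K j` balls, so after this many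
  -- steps colour `i₀` has more than `k`.
  refine ⟨k + 1 + ∑ j ∈ Finset.univ.erase i₀, K j, ?_⟩
  set n := k + 1 + ∑ j ∈ Finset.univ.erase i₀, K j with hn
  have h1 := h.sum_eq n
  have h2 : ∑ j ∈ Finset.univ.erase i₀, w n j ≤ ∑ j ∈ Finset.univ.erase i₀, K j :=
    Finset.sum_le_sum fun j hj =>
      h.bounded hlt (hK j (Finset.ne_of_mem_erase hj)) (hKT j (Finset.ne_of_mem_erase hj)).le n
  rw [← Finset.add_sum_erase _ _ (Finset.mem_univ i₀)] at h1
  omega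

lemma exists_eventually_const {f : ℕ → ℕ} (hf : Monotone f) {K : ℕ} (hK : ∀ n, f n ≤ K) :
    ∃ N, ∀ n ≥ N, f n = f N := by
  obtain ⟨N, hN⟩ := WellFoundedGT.monotone_chain_condition
    (⟨fun n => (⟨f n, Nat.lt_succ_of_le (hK n)⟩ : Fin (K + 1)), fun a b h => hf h⟩ :
      ℕ →o Fin (K + 1))
  exact ⟨N, fun n hn => (congrArg Fin.val (hN n hn)).symm⟩

/-- Only the first colour to explode is a strong monopolist. -/
lemma Greedy.sMon_iff (h : Greedy s w) (hlt : ∀ k ≥ w 0 i₀, s i₀ k < T)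
    (hoth : ∀ j ≠ i₀, ∃ K ≥ w 0 j, T < s j K) (i : Fin A) :
    (∃ N, ∀ n ≥ N, ∀ j ≠ i, w n j = w N j) ↔ i = i₀ := by
  constructor
  · rintro ⟨N, hN⟩
    by_contra hne
    obtain ⟨n, hn⟩ := h.unbounded hlt hoth (w N i₀)
    have h1 := h.monotone i₀ (le_max_left n N)
    have h2 := hN _ (le_max_right n N) i₀ (Ne.symm hne)
    simp only at h1
    omega
  · rintro rfl
    have : ∀ j, j ≠ i → ∃ N, ∀ n ≥ N, w n j = w N j := fun j hj => by
      obtain ⟨K, hK, hKT⟩ := hoth j hj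
      exact exists_eventually_const (h.monotone j) (h.bounded hlt hK hKT.le)
    choose! N hN using this
    refine ⟨Finset.univ.sup N, fun n hn j hj => ?_⟩
    have hle : N j ≤ Finset.univ.sup N := Finset.le_sup (Finset.mem_univ j)
    rw [hN j hj n (hle.trans hn), hN j hj _ hle]

/-- A colour passes the level `x` iff its ring time at this level is before the explosion. -/
lemma Greedy.exists_lt_iff (h : Greedy s w) (hlt : ∀ k ≥ w 0 i₀, s i₀ k < T)
    (hsup : ∀ c < T, ∃ k ≥ w 0 i₀, c < s i₀ k)
    (hoth : ∀ j ≠ i₀, ∃ K ≥ w 0 j, T < s j K) (hmono : ∀ j, Monotone (s j)) {j : Fin A} {x : ℕ}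
    (hx : w 0 j ≤ x) (hne : s j x ≠ T) : (∃ n, x < w n j) ↔ s j x ≤ T := by
  constructor
  · rintro ⟨n, hn⟩
    obtain ⟨m, -, hm⟩ := h.exists_draw hx hn
    exact (hm i₀).trans (hlt _ (h.monotone i₀ (Nat.zero_le m))).le
  · intro hle
    by_contra! hn
    -- If `j` stayed at or below `x`, then `i₀` would eventually be drawn at a ring later than `s j
    -- x`, while `j` still offers a ring no later than that.
    obtain ⟨k, hk, hsk⟩ := hsup _ (lt_of_le_of_ne hle hne)
    obtain ⟨n, hkn⟩ := h.unbounded hlt hoth k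
    obtain ⟨m, -, hm⟩ := h.exists_draw hk hkn
    have := (hm j).trans (hmono j (hn m))
    linarith

end Greedy

/-! ### The embedded urn follows the explosion times -/

section EmbeddedPath

variable {A : ℕ}

/-- The time of the ring of colour `j` at level `k`. -/
noncomputable def ringTime (y : Fin A → ℕ) (τ : Fin A × ℕ → ℝ) (j : Fin A) (k : ℕ) : ℝ :=
  ∑ l ∈ Finset.Ico (y j) (k + 1), τ (j, l)

/-- All ring times shift by the same amount: colour `c` loses its first summand, and every other
colour has its first summand shortened. The order of the ring times is therefore preserved. -/
lemma ringTime_afterRing (y : Fin A → ℕ) (τ : Fin A × ℕ → ℝ) (c j : Fin A) {k : ℕ}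
    (hk : (y + Pi.single c 1 : Fin A → ℕ) j ≤ k) :
    ringTime (y + Pi.single c 1) (afterRing y c τ) j k = ringTime y τ j k - τ (c, y c) := by
  unfold ringTime
  by_cases hj : j = c
  · subst hj
    simp only [Pi.add_apply, Pi.single_eq_same] at hk ⊢
    rw [Finset.sum_eq_sum_Ico_succ_bot (show y j < k + 1 by omega)]
    simp [afterRing_apply]
  · simp only [Pi.add_apply, Pi.single_eq_of_ne hj, add_zero] at hk ⊢
    rw [Finset.sum_eq_sum_Ico_succ_bot (show y j < k + 1 by omega),
      Finset.sum_eq_sum_Ico_succ_bot (show y j < k + 1 by omega)]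
    have : ∑ l ∈ Finset.Ico (y j + 1) (k + 1), afterRing y c τ (j, l) =
        ∑ l ∈ Finset.Ico (y j + 1) (k + 1), τ (j, l) := by
      refine Finset.sum_congr rfl fun l hl => ?_
      rw [afterRing_apply, if_neg]
      have := (Finset.mem_Ico.1 hl).1
      omega
    rw [this, afterRing_apply, if_pos ⟨hj, rfl⟩]
    ring

/-- The time of the ring of colour `j` at level `k`, as an extended nonnegative number. -/
noncomputable def partialTime (y : Fin A → ℕ) (j : Fin A) (k : ℕ) (τ : Fin A × ℕ → ℝ) : ℝ≥0∞ :=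
  ∑ l ∈ Finset.Ico (y j) (k + 1), ENNReal.ofReal (τ (j, l))

lemma partialTime_eq {y : Fin A → ℕ} {τ : Fin A × ℕ → ℝ} (hτ : ∀ p, 0 < τ p) (j : Fin A) (k : ℕ) :
    partialTime y j k τ = ENNReal.ofReal (ringTime y τ j k) :=
  (ENNReal.ofReal_sum_of_nonneg fun _ _ => (hτ _).le).symm

lemma tsum_Ici (m : ℕ) (f : ℕ → ℝ≥0∞) : ∑' k : Set.Ici m, f k = ∑' l, f (m + l) := by
  let e : ℕ ≃ Set.Ici m :=
    { toFun := fun l => ⟨m + l, Nat.le_add_right m l⟩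
      invFun := fun k => k - m
      left_inv := fun l => by simp
      right_inv := fun k => Subtype.ext (Nat.add_sub_cancel' k.2) }
  exact (e.tsum_eq fun k : Set.Ici m => f k).symm

lemma explosionTime_eq_iSup (y : Fin A → ℕ) (j : Fin A) (τ : Fin A × ℕ → ℝ) :
    explosionTime y j τ = ⨆ k : ℕ, partialTime y j (y j + k) τ := by
  unfold explosionTime
  rw [tsum_Ici (y j) fun k => ENNReal.ofReal (τ (j, k)), ENNReal.tsum_eq_iSup_nat]
  have : ∀ n, ∑ a ∈ Finset.range n, ENNReal.ofReal (τ (j, y j + a)) =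
      ∑ l ∈ Finset.Ico (y j) (y j + n), ENNReal.ofReal (τ (j, l)) := fun n => by
    rw [Finset.sum_Ico_eq_sum_range, Nat.add_sub_cancel_left]
  simp only [this, partialTime]
  refine le_antisymm (iSup_le fun n => ?_) (iSup_le fun n => ?_)
  · refine le_iSup_of_le n (Finset.sum_le_sum_of_subset ?_)
    exact Finset.Ico_subset_Ico_right (by omega)
  · exact le_iSup_of_le (n + 1) le_rfl

/-- The clocks avoid the null set on which the embedding is ambiguous. -/
structure Generic (y : Fin A → ℕ) (τ : Fin A × ℕ → ℝ) : Prop where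
  pos : ∀ p, 0 < τ p
  explosive : ∀ i, explosionTime y i τ ≠ ∞
  ne : ∀ i j, i ≠ j → explosionTime y i τ ≠ explosionTime y j τ
  partial_ne : ∀ i j, i ≠ j → ∀ x ≥ y j, partialTime y j x τ ≠ explosionTime y i τ

variable {y : Fin A → ℕ} {τ : Fin A × ℕ → ℝ}

lemma ringTime_mono (hτ : ∀ p, 0 < τ p) (j : Fin A) : Monotone (ringTime y τ j) :=
  fun _ _ h => Finset.sum_le_sum_of_subset_of_nonneg
    (Finset.Ico_subset_Ico_right (by omega)) fun _ _ _ => (hτ _).le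

lemma ringTime_nonneg (hτ : ∀ p, 0 < τ p) (j : Fin A) (k : ℕ) : 0 ≤ ringTime y τ j k :=
  Finset.sum_nonneg fun _ _ => (hτ _).le

lemma ringTime_lt_succ (hτ : ∀ p, 0 < τ p) (j : Fin A) {k : ℕ} (hk : y j ≤ k) :
    ringTime y τ j k < ringTime y τ j (k + 1) := by
  unfold ringTime
  rw [Finset.sum_Ico_succ_top (show y j ≤ k + 1 by omega)]
  linarith [hτ (j, k + 1)]

lemma ringTime_lt_toReal (hτ : ∀ p, 0 < τ p) (j : Fin A) {k : ℕ} (hk : y j ≤ k)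
    (hT : explosionTime y j τ ≠ ∞) : ringTime y τ j k < (explosionTime y j τ).toReal := by
  refine (ringTime_lt_succ hτ j hk).trans_le ?_
  rw [← ENNReal.ofReal_le_iff_le_toReal hT, ← partialTime_eq hτ, explosionTime_eq_iSup]
  exact le_iSup_of_le (k + 1 - y j) (by rw [Nat.add_sub_cancel' (by omega)])

lemma exists_lt_ringTime (hτ : ∀ p, 0 < τ p) (j : Fin A) {c : ℝ}
    (hc : ENNReal.ofReal c < explosionTime y j τ) : ∃ k ≥ y j, c < ringTime y τ j k := by
  rw [explosionTime_eq_iSup] at hc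
  obtain ⟨k, hk⟩ := lt_iSup_iff.1 hc
  rw [partialTime_eq hτ] at hk
  exact ⟨y j + k, Nat.le_add_right _ _, (ENNReal.ofReal_lt_ofReal_iff'.1 hk).1⟩

/-- The minimal explosion time of the colours from `a` on. -/
noncomputable def firstExplosion (y : Fin A → ℕ) (a : ℕ) (τ : Fin A × ℕ → ℝ) : ℝ≥0∞ :=
  ⨅ j : {j : Fin A // a ≤ (j : ℕ)}, explosionTime y j τ

lemma mem_first {A a : ℕ} {i : Fin A} : i ∈ first A a ↔ (i : ℕ) < a := by simp [first]

variable [NeZero A]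

lemma Generic.exists_first (h : Generic y τ) :
    ∃ i₀, ∀ j ≠ i₀, explosionTime y i₀ τ < explosionTime y j τ := by
  obtain ⟨i₀, hi₀⟩ := Finite.exists_min fun j => explosionTime y j τ
  exact ⟨i₀, fun j hj => lt_of_le_of_ne (hi₀ j) (h.ne _ _ (Ne.symm hj))⟩

lemma le_embedded (n : ℕ) (y : Fin A → ℕ) (τ : Fin A × ℕ → ℝ) : y ≤ embedded n y τ := by
  induction n generalizing y τ with
  | zero => exact le_rfl
  | succ n ih =>
    rw [embedded]
    exact le_trans (le_add_of_nonneg_right (Pi.single_nonneg.2 zero_le_one)) (ih _ _)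

lemma greedy_embedded (y : Fin A → ℕ) (τ : Fin A × ℕ → ℝ) :
    Greedy (ringTime y τ) fun n => embedded n y τ := by
  intro n
  induction n generalizing y τ with
  | zero =>
    refine ⟨earliest fun j => τ (j, y j), rfl, fun j => ?_⟩
    simpa [ringTime, embedded_zero] using (ringsFirst_earliest fun j => τ (j, y j)).le j
  | succ n ih =>
    obtain ⟨i, hi, hs⟩ := ih (y + Pi.single (earliest fun j => τ (j, y j)) 1)
      (afterRing y (earliest fun j => τ (j, y j)) τ)
    refine ⟨i, hi, fun j => ?_⟩
    have := hs j
    rw [ringTime_afterRing _ _ _ _ (le_embedded _ _ _ _),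
      ringTime_afterRing _ _ _ _ (le_embedded _ _ _ _)] at this
    exact sub_le_sub_iff_right _ |>.1 this

/-- Here the deterministic facts on greedy paths are applied to the ring times, with `T` the
earliest explosion time. Genericity excludes ties between `T` and the rings of the other colours. -/
lemma Generic.path (h : Generic y τ) {i₀ : Fin A}
    (hi₀ : ∀ j ≠ i₀, explosionTime y i₀ τ < explosionTime y j τ) :
    (∀ i, τ ∈ sMon (fun n => embedded n y) i ↔ i = i₀) ∧
    ∀ j ≠ i₀, ∀ x ≥ y j, ((x : ℕ∞) < final (fun n => embedded n y) j τ ↔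
      partialTime y j x τ ≤ explosionTime y i₀ τ) := by
  set T := (explosionTime y i₀ τ).toReal with hT
  have hTe : ENNReal.ofReal T = explosionTime y i₀ τ := ENNReal.ofReal_toReal (h.explosive i₀)
  have hg := greedy_embedded y τ
  have hlt : ∀ k ≥ y i₀, ringTime y τ i₀ k < T := fun k hk =>
    ringTime_lt_toReal h.pos i₀ hk (h.explosive i₀)
  have hsup : ∀ c < T, ∃ k ≥ y i₀, c < ringTime y τ i₀ k := by
    intro c hc
    refine exists_lt_ringTime h.pos i₀ ?_
    have h0 : 0 < T := (ringTime_nonneg h.pos i₀ (y i₀)).trans_lt (hlt _ le_rfl)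
    rw [← hTe]
    exact (ENNReal.ofReal_lt_ofReal_iff h0).2 hc
  have hoth : ∀ j ≠ i₀, ∃ K ≥ y j, T < ringTime y τ j K := fun j hj =>
    exists_lt_ringTime h.pos j (hTe ▸ hi₀ j hj)
  refine ⟨fun i => hg.sMon_iff hlt hoth i, fun j hj x hx => ?_⟩
  have hne : ringTime y τ j x ≠ T := by
    intro he
    refine h.partial_ne i₀ j (Ne.symm hj) x hx ?_
    rw [partialTime_eq h.pos, he, hTe]
  rw [final, lt_iSup_iff]
  simp only [Nat.cast_lt]
  rw [hg.exists_lt_iff hlt hsup hoth (ringTime_mono h.pos) hx hne, partialTime_eq h.pos, ← hTe]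
  exact (ENNReal.ofReal_le_ofReal_iff ENNReal.toReal_nonneg).symm

lemma Generic.losers_iff (h : Generic y τ) {a : ℕ} :
    τ ∈ losers (fun n => embedded n y) a ↔
      ∀ i ∈ first A a, firstExplosion y a τ < explosionTime y i τ := by
  obtain ⟨i₀, hi₀⟩ := h.exists_first
  have hp := (h.path hi₀).1
  simp only [losers, mem_ofPred_eq, hp]
  constructor
  · intro hl i hi
    have h1 : a ≤ (i₀ : ℕ) := by
      by_contra! hc
      exact hl i₀ (mem_first.2 hc) rfl
    exact (iInf_le (fun j : {j : Fin A // a ≤ (j : ℕ)} => explosionTime y j τ) ⟨i₀, h1⟩).trans_lt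
      (hi₀ i (hl i hi))
  · rintro hl i hi rfl
    have := hl i hi
    obtain ⟨j, hj⟩ := iInf_lt_iff.1 this
    have hji : (j : Fin A) ≠ i := by
      intro he
      have h1 := j.2
      rw [he] at h1
      exact absurd (mem_first.1 hi) (not_lt.2 h1)
    exact lt_asymm hj (hi₀ j hji)

lemma Generic.final_iff (h : Generic y τ) {a : ℕ}
    (hl : τ ∈ losers (fun n => embedded n y) a) {i : Fin A} (hi : i ∈ first A a) {x : ℕ}
    (hx : y i ≤ x) : (x : ℕ∞) < final (fun n => embedded n y) i τ ↔
      partialTime y i x τ ≤ firstExplosion y a τ := by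
  obtain ⟨i₀, hi₀⟩ := h.exists_first
  obtain ⟨hp1, hp2⟩ := h.path hi₀
  have hl' : ∀ i ∈ first A a, i ≠ i₀ := by simpa only [losers, mem_ofPred_eq, hp1] using hl
  have h1 : a ≤ (i₀ : ℕ) := by
    by_contra! hc
    exact hl' i₀ (mem_first.2 hc) rfl
  have hS : firstExplosion y a τ = explosionTime y i₀ τ := by
    refine le_antisymm
      (iInf_le (fun j : {j : Fin A // a ≤ (j : ℕ)} => explosionTime y j τ) ⟨i₀, h1⟩)
      (le_iInf fun j => ?_)
    by_cases hj : (j : Fin A) = i₀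
    · rw [hj]
    · exact (hi₀ j hj).le
  rw [hS, hp2 i (hl' i hi) x hx]

end EmbeddedPath

/-! ### Resampling one clock -/

section Resample

variable {ι : Type*}

lemma lintegral_eval_expFamily (r : ι → Ioi (0 : ℝ)) (p : ι) :
    ∫⁻ τ, ENNReal.ofReal (τ p) ∂expFamily r = ENNReal.ofReal (1 / r p) := by
  have hmp : MeasurePreserving (Function.eval p) (expFamily r) (expMeasure (r p : ℝ)) :=
    measurePreserving_eval_infinitePi _ p
  rw [← lintegral_ofReal_expMeasure (r p).2]
  exact hmp.lintegral_comp ENNReal.measurable_ofReal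

variable [DecidableEq ι]

/-- Independence of one clock from events that do not involve it, with non-involvement expressed as
invariance under updating that coordinate. -/
lemma expFamily_inter_eval (r : ι → Ioi (0 : ℝ)) (p : ι) {E : Set (ι → ℝ)} (hE : MeasurableSet E)
    (hEp : ∀ τ e, Function.update τ p e ∈ E ↔ τ ∈ E) {B : Set ℝ} (hB : MeasurableSet B) :
    expFamily r (E ∩ {τ | τ p ∈ B}) = expFamily r E * expMeasure (r p : ℝ) B := by
  have hm : MeasurableSet (E ∩ {τ : ι → ℝ | τ p ∈ B}) :=
    hE.inter (measurable_pi_apply (X := fun _ : ι => ℝ) p hB)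
  conv_lhs => rw [← expFamily_resample r p]
  rw [Measure.map_apply (measurable_update_uncurry p) hm]
  have : (fun x : ℝ × (ι → ℝ) => Function.update x.2 p x.1) ⁻¹' (E ∩ {τ | τ p ∈ B}) = B ×ˢ E := by
    ext x
    simp only [mem_preimage, mem_inter_iff, hEp, mem_ofPred_eq, Function.update_self, mem_prod]
    exact and_comm
  rw [this, Measure.prod_prod, mul_comm]

lemma expFamily_eval (r : ι → Ioi (0 : ℝ)) (p : ι) {B : Set ℝ} (hB : MeasurableSet B) :
    expFamily r {τ | τ p ∈ B} = expMeasure (r p : ℝ) B := by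
  have h := expFamily_inter_eval r p .univ (by simp) hB
  simpa using h

lemma ae_pos_expFamily [Countable ι] (r : ι → Ioi (0 : ℝ)) : ∀ᵐ τ ∂expFamily r, ∀ p, 0 < τ p := by
  refine ae_all_iff.2 fun p => ?_
  rw [ae_iff]
  have := expFamily_eval r p (B := Iic 0) measurableSet_Iic
  rw [(by ext; simp : {τ : ι → ℝ | ¬ 0 < τ p} = {τ | τ p ∈ Iic (0 : ℝ)}), this]
  have h := ae_pos_expMeasure (r p : ℝ)
  rw [ae_iff] at h
  rwa [(by ext; simp : Iic (0 : ℝ) = {x | ¬ 0 < x})]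

/-- The sum of a clock and an independent finite time has no atoms, even random ones. -/
lemma ae_ofReal_add_ne (r : ι → Ioi (0 : ℝ)) (p : ι) {W Z : (ι → ℝ) → ℝ≥0∞}
    (hW : Measurable W) (hZ : Measurable Z) (hWp : ∀ τ e, W (Function.update τ p e) = W τ)
    (hZp : ∀ τ e, Z (Function.update τ p e) = Z τ) (hfin : ∀ᵐ τ ∂expFamily r, W τ ≠ ∞) :
    ∀ᵐ τ ∂expFamily r, Z τ ≠ ENNReal.ofReal (τ p) + W τ := by
  have hm : MeasurableSet {τ | Z τ = ENNReal.ofReal (τ p) + W τ} :=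
    measurableSet_eq_fun hZ ((ENNReal.measurable_ofReal.comp (by fun_prop)).add hW)
  rw [ae_iff]
  simp only [ne_eq, not_not]
  conv_lhs => rw [← expFamily_resample r p]
  rw [Measure.map_apply (measurable_update_uncurry p) hm,
    Measure.prod_apply_symm (measurable_update_uncurry p hm)]
  rw [lintegral_eq_zero_iff (measurable_measure_prodMk_right (measurable_update_uncurry p hm))]
  filter_upwards [hfin] with τ hτ
  -- With the other clocks fixed and `W` finite, equality forces a positive value of clock `p` to be
  -- the single number `Z - W`.
  refine measure_mono_null (t := Iic 0 ∪ {(Z τ - W τ).toReal}) ?_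
    (measure_union_null ?_ (measure_singleton _))
  · intro e he
    simp only [mem_preimage, mem_ofPred_eq, hWp, hZp, Function.update_self] at he
    rcases le_or_gt e 0 with h0 | h0
    · exact Or.inl h0
    · right
      rw [mem_singleton_iff, he, ENNReal.add_sub_cancel_right hτ, ENNReal.toReal_ofReal h0.le]
  · have h := ae_pos_expMeasure (r p : ℝ)
    rw [ae_iff] at h
    rwa [(by ext; simp : Iic (0 : ℝ) = {x | ¬ 0 < x})]

end Resample

/-! ### Explosion times of a single birth process -/

section Row

/-- The time needed by the birth process with sojourn times `ρ` to explode from level `m`. -/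
noncomputable def tailTime (m : ℕ) (ρ : ℕ → ℝ) : ℝ≥0∞ := ∑' l, ENNReal.ofReal (ρ (m + l))

/-- The time of the ring at level `x` when starting from level `m`. -/
noncomputable def headTime (m x : ℕ) (ρ : ℕ → ℝ) : ℝ≥0∞ :=
  ∑ l ∈ Finset.Ico m (x + 1), ENNReal.ofReal (ρ l)

lemma measurable_tailTime (m : ℕ) : Measurable (tailTime m) :=
  Measurable.tsum fun _ => ENNReal.measurable_ofReal.comp (by fun_prop)

lemma measurable_headTime (m x : ℕ) : Measurable (headTime m x) :=
  Finset.measurable_fun_sum _ fun _ _ => ENNReal.measurable_ofReal.comp (by fun_prop)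

lemma tailTime_eq_add (m : ℕ) (ρ : ℕ → ℝ) :
    tailTime m ρ = ENNReal.ofReal (ρ m) + tailTime (m + 1) ρ := by
  unfold tailTime
  rw [tsum_eq_zero_add' ENNReal.summable]
  simp only [add_zero]
  congr 1
  exact tsum_congr fun l => by rw [add_right_comm, add_assoc]

lemma tailTime_eq_headTime_add (m x : ℕ) (h : m ≤ x) (ρ : ℕ → ℝ) :
    tailTime m ρ = headTime m x ρ + tailTime (x + 1) ρ := by
  induction x, h using Nat.le_induction with
  | base => rw [tailTime_eq_add]; simp [headTime]
  | succ x h ih =>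
    rw [ih, tailTime_eq_add (x + 1), headTime, headTime,
      Finset.sum_Ico_succ_top (show m ≤ x + 1 by omega), ← add_assoc]

lemma tailTime_update {m p : ℕ} (h : p < m) (ρ : ℕ → ℝ) (e : ℝ) :
    tailTime m (Function.update ρ p e) = tailTime m ρ :=
  tsum_congr fun l => by rw [Function.update_of_ne (by omega)]

lemma headTime_update {m x p : ℕ} (h : x < p) (ρ : ℕ → ℝ) (e : ℝ) :
    headTime m x (Function.update ρ p e) = headTime m x ρ :=
  Finset.sum_congr rfl fun l hl => by
    rw [Function.update_of_ne (by have := Finset.mem_Ico.1 hl; omega)]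

variable (F : Feedback)

/-- The distribution function of the explosion time from level `m`. -/
noncomputable def explosionCDF (m : ℕ) (t : ℝ) : ℝ :=
  (expFamily F).real {ρ | tailTime m ρ ≤ ENNReal.ofReal t}

lemma measurableSet_tailTime_le (m : ℕ) (c : ℝ≥0∞) : MeasurableSet {ρ | tailTime m ρ ≤ c} :=
  measurableSet_le (measurable_tailTime m) measurable_const

lemma measurableSet_headTime_le (m x : ℕ) (c : ℝ≥0∞) : MeasurableSet {ρ | headTime m x ρ ≤ c} :=
  measurableSet_le (measurable_headTime m x) measurable_const

lemma explosionCDF_nonneg (m : ℕ) (t : ℝ) : 0 ≤ explosionCDF F m t := measureReal_nonneg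

lemma explosionCDF_le_one (m : ℕ) (t : ℝ) : explosionCDF F m t ≤ 1 := measureReal_le_one

lemma explosionCDF_mono (m : ℕ) : Monotone (explosionCDF F m) := fun _ _ h =>
  measureReal_mono fun _ hρ => le_trans hρ (ENNReal.ofReal_le_ofReal h)

lemma measurable_explosionCDF (m : ℕ) : Measurable (explosionCDF F m) :=
  (explosionCDF_mono F m).measurable

lemma expMeasure_real_Ioi {r : ℝ} (hr : 0 < r) {e : ℝ} (he : 0 ≤ e) :
    (expMeasure r).real (Ioi e) = Real.exp (-(r * e)) := by
  rw [measureReal_def, expMeasure_Ioi hr he, ENNReal.toReal_ofReal (Real.exp_nonneg _)]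

lemma expMeasure_real_Iic {r : ℝ} (hr : 0 < r) {e : ℝ} (he : 0 ≤ e) :
    (expMeasure r).real (Iic e) = 1 - Real.exp (-(r * e)) := by
  have := isProbabilityMeasure_expMeasure hr
  rw [← compl_Ioi, probReal_compl_eq_one_sub measurableSet_Ioi, expMeasure_real_Ioi hr he]

/-- Decomposition at the first sojourn time `e`: the process must then explode from level `m + 1`
within the remaining time `t - e`. -/
lemma explosionCDF_lintegral (m : ℕ) (t : ℝ) :
    ENNReal.ofReal (explosionCDF F m t) = ∫⁻ e in Ioc 0 t,
      ENNReal.ofReal (F m * Real.exp (-(F m * e)) * explosionCDF F (m + 1) (t - e)) := by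
  have hm := measurableSet_tailTime_le m (ENNReal.ofReal t)
  rw [explosionCDF, ofReal_measureReal]
  conv_lhs => rw [← expFamily_resample F m]
  rw [Measure.map_apply (measurable_update_uncurry m) hm,
    Measure.prod_apply (measurable_update_uncurry m hm),
    lintegral_expMeasure _ (measurable_measure_prodMk_left (measurable_update_uncurry m hm)),
    ← lintegral_indicator measurableSet_Ioc]
  refine lintegral_congr_ae ?_
  filter_upwards [measure_eq_zero_iff_ae_notMem.1 (measure_singleton (μ := volume) (0 : ℝ))]
    with e he0
  rcases lt_or_ge e 0 with hneg | hnn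
  · rw [exponentialPDF_of_neg hneg, indicator_of_notMem (fun h => absurd h.1 (not_lt.2 hneg.le)),
      zero_mul]
  have hpos : 0 < e := lt_of_le_of_ne hnn fun h => he0 (by simp [h])
  have hset : Prod.mk e ⁻¹' ((fun x : ℝ × (ℕ → ℝ) => Function.update x.2 m x.1) ⁻¹'
      {ρ | tailTime m ρ ≤ ENNReal.ofReal t}) =
      {ρ | ENNReal.ofReal e + tailTime (m + 1) ρ ≤ ENNReal.ofReal t} := by
    ext ρ
    simp only [mem_preimage, mem_ofPred_eq]
    rw [tailTime_eq_add, Function.update_self, tailTime_update (Nat.lt_succ_self m)]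
  rw [hset, exponentialPDF_of_nonneg hnn]
  by_cases het : e ≤ t
  · rw [indicator_of_mem (show e ∈ Ioc 0 t from ⟨hpos, het⟩), ENNReal.ofReal_mul
      (mul_nonneg (le_of_lt (F m).2) (Real.exp_nonneg _)), explosionCDF, ofReal_measureReal]
    congr 2
    ext ρ
    simp only [mem_ofPred_eq]
    rw [ENNReal.ofReal_sub _ hnn]
    exact (ENNReal.le_sub_iff_add_le_left ENNReal.ofReal_ne_top
      (ENNReal.ofReal_le_ofReal het)).symm
  · rw [indicator_of_notMem (fun h => het h.2)]
    have : {ρ | ENNReal.ofReal e + tailTime (m + 1) ρ ≤ ENNReal.ofReal t} = ∅ := by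
      ext ρ
      simp only [mem_ofPred_eq, mem_empty_iff_false, iff_false, not_le]
      exact lt_of_lt_of_le ((ENNReal.ofReal_lt_ofReal_iff hpos).2 (not_le.1 het)) le_self_add
    rw [this]; simp

lemma explosionCDF_of_nonpos (m : ℕ) {t : ℝ} (ht : t ≤ 0) : explosionCDF F m t = 0 := by
  have h := explosionCDF_lintegral F m t
  rw [Ioc_eq_empty (not_lt.2 ht)] at h
  simp only [Measure.restrict_empty, lintegral_zero_measure, ENNReal.ofReal_eq_zero] at h
  exact le_antisymm h (explosionCDF_nonneg F m t)

lemma intervalIntegrable_exp_mul_explosionCDF (m : ℕ) (c a b : ℝ) :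
    IntervalIntegrable (fun u => c * Real.exp (c * u) * explosionCDF F m u) volume a b := by
  refine IntervalIntegrable.continuousOn_mul ?_ (by fun_prop)
  exact (explosionCDF_mono F m).intervalIntegrable

/-- Substituting `u = t - e` in the first-sojourn convolution moves `t` out of the integrand,
leaving an ordinary primitive that can be differentiated directly. -/
lemma explosionCDF_eq (m : ℕ) {t : ℝ} (ht : 0 ≤ t) :
    explosionCDF F m t = Real.exp (-(F m * t)) *
      ∫ u in (0 : ℝ)..t, F m * Real.exp (F m * u) * explosionCDF F (m + 1) u := by
  have hF := (F m).2
  have h0 : ∀ e, 0 ≤ (F m : ℝ) * Real.exp (-(F m * e)) * explosionCDF F (m + 1) (t - e) :=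
    fun e => mul_nonneg (mul_nonneg hF.le (Real.exp_nonneg _)) (explosionCDF_nonneg F _ _)
  have hmeas : Measurable fun e => (F m : ℝ) * Real.exp (-(F m * e)) *
      explosionCDF F (m + 1) (t - e) := by
    have := measurable_explosionCDF F (m + 1)
    fun_prop
  have h1 : explosionCDF F m t = ∫ e in (0 : ℝ)..t,
      F m * Real.exp (-(F m * e)) * explosionCDF F (m + 1) (t - e) := by
    rw [intervalIntegral.integral_of_le ht,
      integral_eq_lintegral_of_nonneg_ae (ae_of_all _ h0) hmeas.aestronglyMeasurable,
      ← explosionCDF_lintegral, ENNReal.toReal_ofReal (explosionCDF_nonneg F _ _)]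
  have h2 := intervalIntegral.integral_comp_sub_left (a := 0) (b := t)
    (fun u => (F m : ℝ) * Real.exp (-(F m * (t - u))) * explosionCDF F (m + 1) u) t
  simp only [sub_sub_cancel, sub_self, sub_zero] at h2
  rw [h1, h2, ← intervalIntegral.integral_const_mul]
  congr 1
  funext u
  rw [show -((F m : ℝ) * (t - u)) = -(F m * t) + F m * u by ring, Real.exp_add]
  ring

lemma continuous_explosionCDF (m : ℕ) : Continuous (explosionCDF F m) := by
  -- The truncation `max t 0` covers negative times. Monotonicity already makes the integrand
  -- integrable, so its primitive is continuous without assuming continuity at level `m + 1`.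
  have h : explosionCDF F m = fun t => Real.exp (-(F m * max t 0)) *
      ∫ u in (0 : ℝ)..(max t 0), F m * Real.exp (F m * u) * explosionCDF F (m + 1) u := by
    funext t
    rw [← explosionCDF_eq F m (le_max_right t 0)]
    rcases le_total t 0 with ht | ht
    · rw [max_eq_right ht, explosionCDF_of_nonpos F m ht, explosionCDF_of_nonpos F m le_rfl]
    · rw [max_eq_left ht]
  have hc := intervalIntegral.continuous_primitive
    (fun a b => intervalIntegrable_exp_mul_explosionCDF F (m + 1) (F m) a b) 0
  rw [h]
  exact (by fun_prop : Continuous fun t : ℝ => Real.exp (-(F m * max t 0))).mul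
    (hc.comp (by fun_prop))

/-- Kolmogorov's backward equation; it supplies an explicit formula for the density `g`. -/
lemma hasDerivAt_explosionCDF (m : ℕ) {t : ℝ} (ht : 0 < t) :
    HasDerivAt (explosionCDF F m)
      (F m * (explosionCDF F (m + 1) t - explosionCDF F m t)) t := by
  have hcont : Continuous fun u => (F m : ℝ) * Real.exp (F m * u) * explosionCDF F (m + 1) u := by
    have := continuous_explosionCDF F (m + 1)
    fun_prop
  have h1 : HasDerivAt (fun t => ∫ u in (0 : ℝ)..t,
      F m * Real.exp (F m * u) * explosionCDF F (m + 1) u)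
      (F m * Real.exp (F m * t) * explosionCDF F (m + 1) t) t :=
    (hcont.integral_hasStrictDerivAt 0 t).hasDerivAt
  have h2 : HasDerivAt (fun t : ℝ => Real.exp (-(F m * t)))
      (Real.exp (-(F m * t)) * (-(F m * 1))) t :=
    (((hasDerivAt_id t).const_mul (F m : ℝ)).neg).exp
  refine ((h2.mul h1).congr_of_eventuallyEq ?_).congr_deriv ?_
  · filter_upwards [lt_mem_nhds ht] with s hs
    exact explosionCDF_eq F m hs.le
  · have he : Real.exp (-(F m * t)) * Real.exp (F m * t) = 1 := by
      rw [← Real.exp_add]; simp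
    rw [explosionCDF_eq F m ht.le]
    linear_combination (F m * explosionCDF F (m + 1) t) * he

variable {F}

lemma Explosive.summable_tail (hF : Explosive F) (m : ℕ) :
    Summable fun l => 1 / (F (m + l) : ℝ) := by
  have h0 : Summable fun k => 1 / (F k : ℝ) := (summable_nat_add_iff 1).1 hF
  simpa only [add_comm m] using (summable_nat_add_iff m).2 h0

lemma Explosive.lintegral_tailTime (hF : Explosive F) (m : ℕ) :
    ∫⁻ ρ, tailTime m ρ ∂expFamily F = ENNReal.ofReal (∑' l, 1 / (F (m + l) : ℝ)) := by
  unfold tailTime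
  have hm : ∀ l, AEMeasurable (fun ρ : ℕ → ℝ => ENNReal.ofReal (ρ (m + l))) (expFamily F) :=
    fun l => (ENNReal.measurable_ofReal.comp (measurable_pi_apply (m + l))).aemeasurable
  rw [lintegral_tsum hm,
    ENNReal.ofReal_tsum_of_nonneg (fun l => one_div_nonneg.2 (le_of_lt (F (m + l)).2))
      (hF.summable_tail m)]
  exact tsum_congr fun l => lintegral_eval_expFamily F (m + l)

lemma Explosive.ae_tailTime_ne_top (hF : Explosive F) (m : ℕ) :
    ∀ᵐ ρ ∂expFamily F, tailTime m ρ ≠ ∞ := by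
  have h := ae_lt_top (measurable_tailTime m) (μ := expFamily F)
    (by rw [hF.lintegral_tailTime]; exact ENNReal.ofReal_ne_top)
  exact h.mono fun _ h => h.ne

lemma explosionCDF_pos_of_succ {m : ℕ} {s t : ℝ} (hs : 0 ≤ s) (hst : s < t)
    (h : 0 < explosionCDF F (m + 1) s) : 0 < explosionCDF F m t := by
  have hE := expFamily_inter_eval F m (measurableSet_tailTime_le (m + 1) (ENNReal.ofReal s))
    (fun τ e => by
      simp only [mem_ofPred_eq]
      rw [tailTime_update (Nat.lt_succ_self m)]) (measurableSet_Iic (a := t - s))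
  have hE' : (expFamily F).real ({ρ | tailTime (m + 1) ρ ≤ ENNReal.ofReal s} ∩
      {ρ | ρ m ∈ Iic (t - s)}) = explosionCDF F (m + 1) s *
        (1 - Real.exp (-(F m * (t - s)))) := by
    rw [measureReal_def, hE, ENNReal.toReal_mul, ← expMeasure_real_Iic (F m).2 (by linarith)]
    rfl
  have hpos : 0 < 1 - Real.exp (-(F m * (t - s))) := by
    rw [sub_pos, Real.exp_lt_one_iff, neg_lt_zero]
    exact mul_pos (F m).2 (sub_pos.2 hst)
  refine (mul_pos h hpos).trans_le (hE' ▸ measureReal_mono fun ρ hρ => ?_)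
  obtain ⟨h1, h2⟩ := hρ
  simp only [mem_ofPred_eq] at h1 h2 ⊢
  rw [tailTime_eq_add]
  calc ENNReal.ofReal (ρ m) + tailTime (m + 1) ρ
      ≤ ENNReal.ofReal (t - s) + ENNReal.ofReal s :=
        add_le_add (ENNReal.ofReal_le_ofReal h2) h1
    _ = ENNReal.ofReal t := by
        rw [← ENNReal.ofReal_add (by linarith) hs, sub_add_cancel]

/-- The explosion time is arbitrarily small with positive probability. -/
lemma Explosive.explosionCDF_pos (hF : Explosive F) (m : ℕ) {t : ℝ} (ht : 0 < t) :
    0 < explosionCDF F m t := by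
  have hind : ∀ (n m : ℕ) (s t : ℝ), 0 ≤ s → s < t → 0 < explosionCDF F (m + n) s →
      0 < explosionCDF F m t := by
    intro n
    induction n with
    | zero => exact fun m s t _ hst h => h.trans_le (explosionCDF_mono F m hst.le)
    | succ n ih =>
      intro m s t hs hst h
      -- Each descent by one level gives half of the spare time to the additional clock.
      refine explosionCDF_pos_of_succ (s := (s + t) / 2) (by linarith) (by linarith) ?_
      exact ih (m + 1) s _ hs (by linarith) (by rwa [add_right_comm, add_assoc])
  have h0 : Summable fun k => 1 / (F k : ℝ) := (summable_nat_add_iff 1).1 hF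
  have hlim := tendsto_sum_nat_add fun k => 1 / (F k : ℝ)
  -- From a high level `K` the mean explosion time is below `t / 2`, so by Markov's inequality
  -- explosion within `t / 2` has positive probability; the finitely many clocks below `K` use the
  -- other half.
  obtain ⟨K, hK, hmK⟩ := ((hlim.eventually (gt_mem_nhds (half_pos ht))).and
    (eventually_ge_atTop m)).exists
  refine hind (K - m) m (t / 2) t (half_pos ht).le (half_lt_self ht) ?_
  rw [Nat.add_sub_cancel' hmK]
  have hmk := mul_meas_ge_le_lintegral (μ := expFamily F) (measurable_tailTime K)
    (ENNReal.ofReal (t / 2))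
  rw [hF.lintegral_tailTime] at hmk
  have hlt : ENNReal.ofReal (∑' l, 1 / (F (K + l) : ℝ)) < ENNReal.ofReal (t / 2) := by
    rw [ENNReal.ofReal_lt_ofReal_iff (half_pos ht)]
    simpa only [add_comm K] using hK
  have h1 : expFamily F {ρ | ENNReal.ofReal (t / 2) ≤ tailTime K ρ} < 1 := by
    by_contra! hge
    have := (le_mul_of_one_le_right' hge).trans hmk
    exact absurd this (not_le.2 hlt)
  have h2 : 0 < expFamily F {ρ | tailTime K ρ ≤ ENNReal.ofReal (t / 2)} := by
    rw [pos_iff_ne_zero]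
    intro h
    have huniv : (univ : Set (ℕ → ℝ)) ⊆ {ρ | tailTime K ρ ≤ ENNReal.ofReal (t / 2)} ∪
        {ρ | ENNReal.ofReal (t / 2) ≤ tailTime K ρ} := fun ρ _ =>
      le_total (tailTime K ρ) (ENNReal.ofReal (t / 2))
    have := (measure_mono (μ := expFamily F) huniv).trans (measure_union_le _ _)
    rw [measure_univ, h, zero_add] at this
    exact absurd this (not_le.2 h1)
  exact ENNReal.toReal_pos h2.ne' (measure_ne_top _ _)

variable (F)

/-- The explosion takes at least the first sojourn time; this keeps the survival function positive
at all times. -/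
lemma explosionCDF_le (m : ℕ) {t : ℝ} (ht : 0 ≤ t) :
    explosionCDF F m t ≤ 1 - Real.exp (-(F m * t)) := by
  rw [← expMeasure_real_Iic (F m).2 ht, measureReal_def,
    ← expFamily_eval (fun k => F k) m measurableSet_Iic]
  refine measureReal_mono fun ρ hρ => ?_
  simp only [mem_ofPred_eq, mem_Iic] at hρ ⊢
  rw [tailTime_eq_add] at hρ
  exact (ENNReal.ofReal_le_ofReal_iff ht).1 (le_self_add.trans hρ)

/-- The survival function of the explosion time from level `m`. -/
noncomputable def tailSurvival (m : ℕ) (t : ℝ) : ℝ :=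
  (expFamily F).real {ρ | ENNReal.ofReal t < tailTime m ρ}

lemma tailSurvival_eq (m : ℕ) (t : ℝ) : tailSurvival F m t = 1 - explosionCDF F m t := by
  rw [tailSurvival, explosionCDF,
    ← probReal_compl_eq_one_sub (measurableSet_tailTime_le m (ENNReal.ofReal t))]
  congr 1
  ext; simp

lemma tailSurvival_pos (m : ℕ) {t : ℝ} (ht : 0 ≤ t) : 0 < tailSurvival F m t := by
  rw [tailSurvival_eq]
  linarith [explosionCDF_le F m ht, Real.exp_pos (-(F m * t))]

/-- The probability that level `x` is passed at time `t` but the explosion is still to come. -/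
noncomputable def passProb (m x : ℕ) (t : ℝ) : ℝ :=
  (expFamily F).real {ρ | headTime m x ρ ≤ ENNReal.ofReal t ∧ ENNReal.ofReal t < tailTime m ρ}

/-- Explosion by time `t` entails passage of level `x` by then. As a difference of two monotone
functions, `passProb` is measurable. -/
lemma passProb_eq_sub {m x : ℕ} (hmx : m ≤ x) (t : ℝ) : passProb F m x t =
    (expFamily F).real {ρ | headTime m x ρ ≤ ENNReal.ofReal t} - explosionCDF F m t := by
  have hsub : {ρ | tailTime m ρ ≤ ENNReal.ofReal t} ⊆ {ρ | headTime m x ρ ≤ ENNReal.ofReal t} := by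
    intro ρ hρ
    simp only [mem_ofPred_eq] at hρ ⊢
    rw [tailTime_eq_headTime_add m x hmx] at hρ
    exact le_self_add.trans hρ
  rw [passProb, explosionCDF, ← measureReal_sdiff hsub (measurableSet_tailTime_le _ _)]
  congr 1
  ext ρ
  simp

lemma measurable_passProb {m x : ℕ} (hmx : m ≤ x) : Measurable (passProb F m x) := by
  have h1 : Monotone fun t : ℝ =>
      (expFamily F).real {ρ | headTime m x ρ ≤ ENNReal.ofReal t} := fun _ _ h =>
    measureReal_mono fun _ hρ => le_trans hρ (ENNReal.ofReal_le_ofReal h)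
  have : passProb F m x = fun t => (expFamily F).real {ρ | headTime m x ρ ≤ ENNReal.ofReal t} -
      explosionCDF F m t := funext (passProb_eq_sub F hmx)
  rw [this]
  exact h1.measurable.sub (measurable_explosionCDF F m)

/-- Passage of level `x` needs the clock at level `m` to ring; the bound forces the limit `0` at
time `0`, the source of strictness in Hölder's inequality. -/
lemma passProb_le {m x : ℕ} (hmx : m ≤ x) {t : ℝ} (ht : 0 ≤ t) :
    passProb F m x t ≤ 1 - Real.exp (-(F m * t)) := by
  rw [← expMeasure_real_Iic (F m).2 ht, measureReal_def,
    ← expFamily_eval (fun k => F k) m measurableSet_Iic]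
  refine measureReal_mono fun ρ hρ => ?_
  simp only [mem_ofPred_eq, mem_Iic] at hρ ⊢
  refine (ENNReal.ofReal_le_ofReal_iff ht).1 (le_trans ?_ hρ.1)
  exact Finset.single_le_sum (f := fun l => ENNReal.ofReal (ρ l)) (fun _ _ => zero_le)
    (Finset.mem_Ico.2 ⟨le_rfl, by omega⟩)

variable {F}

/-- The head can be short while the independent clock at level `x + 1` alone exceeds `t`. -/
lemma Explosive.passProb_pos (hF : Explosive F) {m x : ℕ} (hmx : m ≤ x) {t : ℝ} (ht : 0 < t) :
    0 < passProb F m x t := by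
  have hE := expFamily_inter_eval F (x + 1) (measurableSet_headTime_le m x (ENNReal.ofReal t))
    (fun τ e => by
      simp only [mem_ofPred_eq]
      rw [headTime_update (Nat.lt_succ_self x)]) (measurableSet_Ioi (a := t))
  have h1 : 0 < expFamily F {ρ | headTime m x ρ ≤ ENNReal.ofReal t} := by
    have h := hF.explosionCDF_pos m ht
    refine (ENNReal.toReal_pos_iff.1 h).1.trans_le (measure_mono fun ρ hρ => ?_)
    simp only [mem_ofPred_eq] at hρ ⊢
    rw [tailTime_eq_headTime_add m x hmx] at hρ
    exact le_self_add.trans hρ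
  have h2 : 0 < expMeasure (F (x + 1) : ℝ) (Ioi t) := by
    rw [expMeasure_Ioi (F (x + 1)).2 ht.le]
    simp [Real.exp_pos]
  refine ENNReal.toReal_pos (ne_of_gt ?_) (measure_ne_top _ _)
  refine (ENNReal.mul_pos h1.ne' h2.ne').trans_le (hE ▸ measure_mono fun ρ hρ => ?_)
  refine ⟨hρ.1, ?_⟩
  have h3 : t < ρ (x + 1) := hρ.2
  rw [tailTime_eq_headTime_add m x hmx, tailTime_eq_add]
  calc ENNReal.ofReal t < ENNReal.ofReal (ρ (x + 1)) :=
        (ENNReal.ofReal_lt_ofReal_iff (ht.trans h3)).2 h3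
    _ ≤ _ := le_self_add
    _ ≤ _ := le_add_self

/-- Exploding from `m` by time `t` also requires the independent clock at level `m` to ring by `t`,
which fails with positive probability. Through the backward equation this is positivity of the
density. -/
lemma Explosive.explosionCDF_lt_succ (hF : Explosive F) (m : ℕ) {t : ℝ} (ht : 0 < t) :
    explosionCDF F m t < explosionCDF F (m + 1) t := by
  have hE := expFamily_inter_eval F m (measurableSet_tailTime_le (m + 1) (ENNReal.ofReal t))
    (fun τ e => by
      simp only [mem_ofPred_eq]
      rw [tailTime_update (Nat.lt_succ_self m)]) (measurableSet_Iic (a := t))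
  have hE' : (expFamily F).real ({ρ | tailTime (m + 1) ρ ≤ ENNReal.ofReal t} ∩
      {ρ | ρ m ∈ Iic t}) = explosionCDF F (m + 1) t * (1 - Real.exp (-(F m * t))) := by
    rw [measureReal_def, hE, ENNReal.toReal_mul, ← expMeasure_real_Iic (F m).2 ht.le]
    rfl
  have h1 : explosionCDF F m t ≤ explosionCDF F (m + 1) t * (1 - Real.exp (-(F m * t))) := by
    refine hE' ▸ measureReal_mono fun ρ hρ => ?_
    simp only [mem_ofPred_eq, mem_inter_iff, mem_Iic] at hρ ⊢
    rw [tailTime_eq_add] at hρ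
    exact ⟨le_add_self.trans hρ, (ENNReal.ofReal_le_ofReal_iff ht.le).1 (le_self_add.trans hρ)⟩
  have h2 := mul_pos (hF.explosionCDF_pos (m + 1) ht) (Real.exp_pos (-(F m * t)))
  linarith

end Row

/-! ### A strict Hölder inequality -/

section Holder

/-- Strict convexity of `u ^ a` against its tangent at `m`: this is Bernoulli's strict inequality
for `u / m`. -/
lemma tangent_pow_lt {a : ℕ} (ha : 2 ≤ a) {m u : ℝ} (hm : 0 < m) (hu : 0 < u) (hne : u ≠ m) :
    m ^ a + a * m ^ (a - 1) * (u - m) < u ^ a := by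
  have h1 : (-1 : ℝ) ≤ u / m - 1 := by have := div_pos hu hm; linarith
  have h2 : u / m - 1 ≠ 0 := by
    intro h
    exact hne ((div_eq_one_iff_eq hm.ne').1 (by linarith))
  have h := one_add_mul_self_lt_rpow_one_add h1 h2 (p := a) (by exact_mod_cast ha)
  rw [add_sub_cancel, Real.rpow_natCast, div_pow, lt_div_iff₀ (pow_pos hm a)] at h
  refine lt_of_eq_of_lt ?_ h
  obtain ⟨b, rfl⟩ : ∃ b, a = b + 1 := ⟨a - 1, by omega⟩
  rw [Nat.add_sub_cancel, pow_succ]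
  field_simp

lemma tangent_pow_mul_lt {a : ℕ} (ha : 2 ≤ a) {m x y : ℝ} (hm : 0 < m) (hx : 0 < x) (hy : 0 < y)
    (hne : x ≠ m * y) :
    m ^ a * y ^ a + a * m ^ (a - 1) * (x * y ^ (a - 1) - m * y ^ a) < x ^ a := by
  have h := tangent_pow_lt ha hm (div_pos hx hy) (fun h => hne ((div_eq_iff hy.ne').1 h))
  rw [div_pow, lt_div_iff₀ (pow_pos hy a)] at h
  refine lt_of_eq_of_lt ?_ h
  obtain ⟨b, rfl⟩ : ∃ b, a = b + 1 := ⟨a - 1, by omega⟩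
  rw [Nat.add_sub_cancel, pow_succ y]
  field_simp

variable {μ : Measure ℝ} [IsProbabilityMeasure μ]

lemma integral_pos_of_ae_pos {f : ℝ → ℝ} (hf : Integrable f μ) (hpos : ∀ᵐ s ∂μ, 0 < f s) :
    0 < ∫ s, f s ∂μ := by
  rw [integral_pos_iff_support_of_nonneg_ae (hpos.mono fun _ h => h.le) hf, pos_iff_ne_zero]
  intro h0
  have h1 : ∀ᵐ s ∂μ, s ∉ Function.support f := measure_eq_zero_iff_ae_notMem.1 h0
  obtain ⟨s, hs1, hs2⟩ := (h1.and hpos).exists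
  exact hs1 hs2.ne'

/-- Hölder's inequality for `h` and `G ^ (a - 1)`, strict because `h / G` is positive and vanishes
at the left end of the support of `μ`. -/
theorem strict_holder {G h : ℝ → ℝ} (hGm : Measurable G) (hhm : Measurable h)
    (hμpos : ∀ᵐ s ∂μ, 0 < s) (hμ : ∀ ε > 0, 0 < μ (Iio ε))
    (hG : ∀ s > 0, 0 < G s) (hG1 : ∀ s > 0, G s ≤ 1) (hh : ∀ s > 0, 0 < h s) {C : ℝ}
    (hhC : ∀ s > 0, h s ≤ C) (hh0 : Tendsto h (𝓝[>] 0) (𝓝 0)) (hG0 : Tendsto G (𝓝[>] 0) (𝓝 1))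
    {a : ℕ} (ha : 2 ≤ a) :
    0 < ∫ s, G s ^ a ∂μ ∧ 0 < ∫ s, h s * G s ^ (a - 1) ∂μ ∧
      (∫ s, h s * G s ^ (a - 1) ∂μ) ^ a < (∫ s, h s ^ a ∂μ) * (∫ s, G s ^ a ∂μ) ^ (a - 1) := by
  have bound : ∀ (p q : ℕ), Integrable (fun s => h s ^ p * G s ^ q) μ := by
    intro p q
    refine Integrable.of_bound ((hhm.pow_const p).mul (hGm.pow_const q)).aestronglyMeasurable
      (C ^ p * 1) ?_
    filter_upwards [hμpos] with s hs
    have e1 := hh s hs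
    have e2 := hG s hs
    rw [Real.norm_of_nonneg (by positivity)]
    exact mul_le_mul (pow_le_pow_left₀ e1.le (hhC s hs) p) (pow_le_one₀ e2.le (hG1 s hs))
      (by positivity) (pow_nonneg (e1.le.trans (hhC s hs)) p)
  have iG : Integrable (fun s => G s ^ a) μ := by simpa using bound 0 a
  have ih : Integrable (fun s => h s ^ a) μ := by simpa using bound a 0
  have iJ : Integrable (fun s => h s * G s ^ (a - 1)) μ := by simpa using bound 1 (a - 1)
  have hI : 0 < ∫ s, G s ^ a ∂μ :=
    integral_pos_of_ae_pos iG (hμpos.mono fun s hs => pow_pos (hG s hs) a)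
  have hJ : 0 < ∫ s, h s * G s ^ (a - 1) ∂μ :=
    integral_pos_of_ae_pos iJ (hμpos.mono fun s hs => mul_pos (hh s hs) (pow_pos (hG s hs) _))
  refine ⟨hI, hJ, ?_⟩
  set I := ∫ s, G s ^ a ∂μ with hIdef
  set J := ∫ s, h s * G s ^ (a - 1) ∂μ with hJdef
  -- With this tangent point, the mean of `h / G` under the weight `G ^ a`, the linear term of the
  -- tangent integrates to zero (Jensen's inequality).
  set m := J / I with hm
  have hmpos : 0 < m := div_pos hJ hI
  let φ : ℝ → ℝ := fun s =>
    h s ^ a - (m ^ a * G s ^ a + a * m ^ (a - 1) * (h s * G s ^ (a - 1) - m * G s ^ a))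
  have i1 : Integrable (fun s => h s * G s ^ (a - 1) - m * G s ^ a) μ := iJ.sub (iG.const_mul m)
  have i2 : Integrable (fun s => a * m ^ (a - 1) * (h s * G s ^ (a - 1) - m * G s ^ a)) μ :=
    i1.const_mul _
  have i3 : Integrable (fun s => m ^ a * G s ^ a +
      a * m ^ (a - 1) * (h s * G s ^ (a - 1) - m * G s ^ a)) μ := (iG.const_mul _).add i2
  have iφ : Integrable φ μ := ih.sub i3
  have hφ : ∫ s, φ s ∂μ = (∫ s, h s ^ a ∂μ) - m ^ a * I := by
    have e1 : ∫ s, φ s ∂μ = (∫ s, h s ^ a ∂μ) - (m ^ a * I + a * m ^ (a - 1) * (J - m * I)) := by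
      simp only [φ]
      rw [integral_sub ih i3, integral_add (iG.const_mul _) i2, integral_const_mul,
        integral_const_mul, integral_sub iJ (iG.const_mul m), integral_const_mul]
    have e2 : m * I = J := div_mul_cancel₀ J hI.ne'
    rw [e1, e2]; ring
  -- Near `0` the ratio `h / G` stays below its mean `m`, so the tangent inequality is strict on an
  -- interval of positive mass.
  have hlt : ∀ᶠ s in 𝓝[>] (0 : ℝ), h s < m * G s := by
    have : Tendsto (fun s => m * G s - h s) (𝓝[>] 0) (𝓝 (m * 1 - 0)) :=
      (hG0.const_mul m).sub hh0
    filter_upwards [this.eventually (lt_mem_nhds (by linarith : (0 : ℝ) < m * 1 - 0))] with s hs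
    linarith
  obtain ⟨ε, hε, hεlt⟩ := mem_nhdsGT_iff_exists_Ioo_subset.1 hlt
  have hφpos : 0 < ∫ s, φ s ∂μ := by
    rw [integral_pos_iff_support_of_nonneg_ae _ iφ]
    · have h1 : 0 < μ (Ioo 0 ε) := by
        have : μ (Ioo 0 ε) = μ (Iio ε) := by
          refine measure_congr ?_
          filter_upwards [hμpos] with s hs
          exact propext ⟨fun h => h.2, fun h => ⟨hs, h⟩⟩
        rw [this]
        exact hμ ε hε
      refine h1.trans_le (measure_mono fun s hs => ?_)
      have hs0 : 0 < s := hs.1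
      exact (sub_pos.2 (tangent_pow_mul_lt ha hmpos (hh s hs0) (hG s hs0) (hεlt hs).ne)).ne'
    · filter_upwards [hμpos] with s hs
      by_cases he : h s = m * G s
      · refine (sub_nonneg.2 (le_of_eq ?_) : 0 ≤ φ s)
        obtain ⟨b, rfl⟩ : ∃ b, a = b + 1 := ⟨a - 1, by omega⟩
        rw [he, Nat.add_sub_cancel]
        ring
      · exact (sub_pos.2 (tangent_pow_mul_lt ha hmpos (hh s hs) (hG s hs) he)).le
  rw [hφ, sub_pos] at hφpos
  calc J ^ a = m ^ a * I * I ^ (a - 1) := by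
        rw [hm, div_pow, mul_assoc, ← pow_succ', Nat.sub_add_cancel (by omega),
          div_mul_cancel₀ _ (pow_pos hI a).ne']
    _ < _ := mul_lt_mul_of_pos_right hφpos (pow_pos hI _)

end Holder

/-! ### Independence of groups of colours -/

section Groups

variable {ι X : Type*} [Fintype ι] [MeasurableSpace X]

/-- Fubini over the two blocks of coordinates: once the block outside `p` is fixed, so is the value
of `g`, and the event becomes a box in the other block. -/
lemma pi_forall_mem_eq_lintegral (ν : Measure X) [IsProbabilityMeasure ν] (p : ι → Prop)
    [DecidablePred p] {g : ({j // ¬ p j} → X) → ℝ≥0∞} (hg : Measurable g)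
    {B : ι → Set (X × ℝ≥0∞)} (hB : ∀ i, MeasurableSet (B i)) :
    Measure.pi (fun _ : ι => ν) {v | ∀ i, p i → (v i, g fun j => v j) ∈ B i} =
      ∫⁻ v, ∏ i with p i, ν {x | (x, g fun j => v j) ∈ B i} ∂Measure.pi (fun _ : ι => ν) := by
  have hmp := measurePreserving_piEquivPiSubtypeProd (fun _ : ι => ν) p
  have hmp2 := measurePreserving_snd (μ := Measure.pi fun _ : Subtype p => ν)
    (ν := Measure.pi fun _ : {j // ¬ p j} => ν) |>.comp hmp
  let C : Set (({i // p i} → X) × ({j // ¬ p j} → X)) :=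
    {z | ∀ i : {i // p i}, (z.1 i, g z.2) ∈ B i}
  have hC : MeasurableSet C := by
    have : C = ⋂ i : {i // p i}, (fun z : ({i // p i} → X) × ({j // ¬ p j} → X) =>
        (z.1 i, g z.2)) ⁻¹' B i := by
      ext; simp [C]
    rw [this]
    refine MeasurableSet.iInter fun i => ?_
    exact (((measurable_pi_apply i).comp measurable_fst).prodMk (hg.comp measurable_snd)) (hB i)
  have hsec : ∀ i, Measurable fun s : ℝ≥0∞ => ν {x | (x, s) ∈ B i} := fun i =>
    measurable_measure_prodMk_right (hB i)
  have e1 : {v : ι → X | ∀ i, p i → (v i, g fun j => v j) ∈ B i} =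
      MeasurableEquiv.piEquivPiSubtypeProd (fun _ => X) p ⁻¹' C := by
    ext v
    simp only [mem_ofPred_eq, mem_preimage, C, Subtype.forall]
    rfl
  have hf : Measurable fun w : {j // ¬ p j} → X =>
      ∏ i with p i, ν {x | (x, g w) ∈ B i} :=
    Finset.measurable_fun_prod _ fun i _ => (hsec i).comp hg
  have e2 := hmp2.lintegral_comp hf
  rw [e1, hmp.measure_preimage hC.nullMeasurableSet, Measure.prod_apply_symm hC]
  refine Eq.trans ?_ e2.symm
  refine lintegral_congr fun w => ?_
  have e3 : (fun u => (u, w)) ⁻¹' C = Set.pi univ fun i : {i // p i} => {x | (x, g w) ∈ B i} := by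
    ext u; simp [C]
  rw [e3, Measure.pi_pi]
  exact (Finset.prod_subtype _ (by simp) fun i => ν {x | (x, g w) ∈ B i}).symm

end Groups

/-! ### Identically distributed colours -/

section Rows

variable {A : ℕ} {F : Feedback} {x₀ a : ℕ}

lemma tendsto_tailSurvival (F : Feedback) (x₀ : ℕ) :
    Tendsto (tailSurvival F x₀) (𝓝[>] 0) (𝓝 1) := by
  have h := ((continuous_explosionCDF F x₀).tendsto 0).const_sub 1
  rw [explosionCDF_of_nonpos F x₀ le_rfl, sub_zero] at h
  exact (h.congr fun t => (tailSurvival_eq F x₀ t).symm).mono_left nhdsWithin_le_nhds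

lemma measurable_tailSurvival (F : Feedback) (x₀ : ℕ) : Measurable (tailSurvival F x₀) := by
  rw [funext (tailSurvival_eq F x₀)]
  exact (measurable_explosionCDF F x₀).const_sub 1

lemma tailSurvival_le_one (F : Feedback) (x₀ : ℕ) (t : ℝ) : tailSurvival F x₀ t ≤ 1 :=
  measureReal_le_one

/-- The sojourn times of colour `i`. -/
def row (i : Fin A) (τ : Fin A × ℕ → ℝ) : ℕ → ℝ := fun k => τ (i, k)

lemma measurable_row (i : Fin A) : Measurable (row i) :=
  measurable_pi_lambda _ fun _ => measurable_pi_apply _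

lemma measurePreserving_row (F : Feedback) (i : Fin A) :
    MeasurePreserving (row i) (clockLaw fun _ : Fin A => F) (expFamily F) :=
  ⟨measurable_row i, Measure.map_infinitePi_infinitePi_of_inj
    (P := fun p : Fin A × ℕ => expMeasure (F p.2 : ℝ)) (f := fun k => (i, k))
    fun _ _ h => (Prod.ext_iff.1 h).2⟩

lemma measurePreserving_rows (F : Feedback) :
    MeasurePreserving (fun τ i => row i τ) (clockLaw fun _ : Fin A => F)
      (Measure.pi fun _ : Fin A => expFamily F) := by
  refine ⟨measurable_pi_lambda _ measurable_row, ?_⟩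
  rw [← Measure.infinitePi_eq_pi]
  exact Measure.infinitePi_map_curry fun (_ : Fin A) k => expMeasure (F k : ℝ)

lemma explosionTime_eq_tailTime (x₀ : ℕ) (i : Fin A) (τ : Fin A × ℕ → ℝ) :
    explosionTime (fun _ => x₀) i τ = tailTime x₀ (row i τ) :=
  tsum_Ici x₀ fun k => ENNReal.ofReal (τ (i, k))

lemma partialTime_eq_headTime (x₀ : ℕ) (i : Fin A) (x : ℕ) (τ : Fin A × ℕ → ℝ) :
    partialTime (fun _ => x₀) i x τ = headTime x₀ x (row i τ) := rfl

lemma measurable_explosionTime (x₀ : ℕ) (i : Fin A) :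
    Measurable (explosionTime (A := A) (fun _ => x₀) i) := by
  have := (measurable_tailTime x₀).comp (measurable_row i)
  rwa [← (funext fun τ => explosionTime_eq_tailTime x₀ i τ :
    explosionTime (fun _ => x₀) i = tailTime x₀ ∘ row i)] at this

lemma Explosive.ae_explosionTime_ne_top (hF : Explosive F) (m : ℕ) (i : Fin A) :
    ∀ᵐ τ ∂clockLaw (fun _ : Fin A => F), tailTime m (row i τ) ≠ ∞ :=
  (measurePreserving_row F i).quasiMeasurePreserving.ae (hF.ae_tailTime_ne_top m)

/-- The first clock of row `i` is independent of row `j` and of the rest of row `i`, and its law has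
no atoms. -/
lemma Explosive.ae_ne_explosionTime (hF : Explosive F) (x₀ : ℕ) {i j : Fin A} (hij : i ≠ j)
    {Z : (ℕ → ℝ) → ℝ≥0∞} (hZ : Measurable Z) :
    ∀ᵐ τ ∂clockLaw (fun _ : Fin A => F), Z (row j τ) ≠ explosionTime (fun _ => x₀) i τ := by
  have h := ae_ofReal_add_ne (fun p : Fin A × ℕ => F p.2) (i, x₀)
    (W := fun τ => tailTime (x₀ + 1) (row i τ)) (Z := fun τ => Z (row j τ))
    ((measurable_tailTime _).comp (measurable_row i)) (hZ.comp (measurable_row j))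
    (fun τ e => by
      refine tsum_congr fun l => ?_
      simp only [row]
      rw [Function.update_of_ne fun h => by have := (Prod.ext_iff.1 h).2; simp only at this; omega])
    (fun τ e => by
      congr 1
      funext k
      simp only [row]
      rw [Function.update_of_ne (by simp [hij.symm])])
    (hF.ae_explosionTime_ne_top (x₀ + 1) i)
  filter_upwards [h] with τ hτ
  rw [explosionTime_eq_tailTime, tailTime_eq_add]
  exact hτ

lemma Explosive.ae_generic (hF : Explosive F) (x₀ : ℕ) :
    ∀ᵐ τ ∂clockLaw (fun _ : Fin A => F), Generic (fun _ => x₀) τ := by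
  have h1 : ∀ᵐ τ ∂clockLaw (fun _ : Fin A => F), ∀ p, 0 < τ p :=
    ae_pos_expFamily fun p : Fin A × ℕ => F p.2
  have h2 : ∀ᵐ τ ∂clockLaw (fun _ : Fin A => F), ∀ i, tailTime x₀ (row i τ) ≠ ∞ :=
    ae_all_iff.2 fun i => hF.ae_explosionTime_ne_top x₀ i
  have h3 : ∀ᵐ τ ∂clockLaw (fun _ : Fin A => F), ∀ i j, i ≠ j →
      tailTime x₀ (row j τ) ≠ explosionTime (fun _ => x₀) i τ := by
    refine ae_all_iff.2 fun i => ae_all_iff.2 fun j => ?_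
    by_cases hij : i = j
    · exact ae_of_all _ fun _ h => absurd hij h
    · exact (hF.ae_ne_explosionTime x₀ hij (measurable_tailTime x₀)).mono fun _ h _ => h
  have h4 : ∀ᵐ τ ∂clockLaw (fun _ : Fin A => F), ∀ i j, i ≠ j → ∀ x,
      headTime x₀ x (row j τ) ≠ explosionTime (fun _ => x₀) i τ := by
    refine ae_all_iff.2 fun i => ae_all_iff.2 fun j => ?_
    by_cases hij : i = j
    · exact ae_of_all _ fun _ h => absurd hij h
    · exact (ae_all_iff.2 fun x => hF.ae_ne_explosionTime x₀ hij (measurable_headTime x₀ x)).mono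
        fun _ h _ => h
  filter_upwards [h1, h2, h3, h4] with τ e1 e2 e3 e4
  exact ⟨e1, fun i => explosionTime_eq_tailTime x₀ i τ ▸ e2 i,
    fun i j hij => (explosionTime_eq_tailTime x₀ j τ ▸ e3 i j hij).symm,
    fun i j hij x _ => e4 i j hij x⟩

/-- The law of the time at which the last `A - a` colours explode first. -/
noncomputable def minLaw (A : ℕ) (F : Feedback) (x₀ a : ℕ) : Measure ℝ :=
  (clockLaw fun _ : Fin A => F).map (minTime (fun _ => x₀) a)

lemma measurable_firstExplosion (x₀ a : ℕ) : Measurable (firstExplosion (A := A) (fun _ => x₀) a) :=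
  Measurable.iInf fun j => measurable_explosionTime x₀ (j : Fin A)

lemma measurable_minTime (x₀ a : ℕ) : Measurable (minTime (A := A) (fun _ => x₀) a) :=
  (measurable_firstExplosion x₀ a).ennreal_toReal

instance : IsProbabilityMeasure (minLaw A F x₀ a) :=
  Measure.isProbabilityMeasure_map (measurable_minTime x₀ a).aemeasurable

lemma Generic.ofReal_minTime {τ : Fin A × ℕ → ℝ} (h : Generic (fun _ => x₀) τ) (ha : a < A) :
    ENNReal.ofReal (minTime (fun _ => x₀) a τ) = firstExplosion (fun _ => x₀) a τ :=
  ENNReal.ofReal_toReal (ne_top_of_le_ne_top (h.explosive ⟨a, ha⟩)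
    (iInf_le (fun j : {j : Fin A // a ≤ (j : ℕ)} => explosionTime (fun _ => x₀) j τ)
      ⟨⟨a, ha⟩, le_rfl⟩))

lemma Explosive.minLaw_pos (hF : Explosive F) (x₀ : ℕ) (ha : a < A) :
    ∀ᵐ s ∂minLaw A F x₀ a, 0 < s := by
  rw [minLaw, ae_map_iff (measurable_minTime x₀ a).aemeasurable measurableSet_Ioi]
  filter_upwards [hF.ae_generic x₀] with τ h
  have hle : ∀ j : {j : Fin A // a ≤ (j : ℕ)}, 0 < explosionTime (fun _ => x₀) j τ := by
    intro j
    rw [explosionTime_eq_tailTime, tailTime_eq_add]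
    exact add_pos_of_pos_of_nonneg (ENNReal.ofReal_pos.2 (h.pos _)) zero_le
  have : Nonempty {j : Fin A // a ≤ (j : ℕ)} := ⟨⟨⟨a, ha⟩, le_rfl⟩⟩
  obtain ⟨j, hj⟩ := exists_eq_ciInf_of_finite
    (f := fun j : {j : Fin A // a ≤ (j : ℕ)} => explosionTime (fun _ => x₀) (j : Fin A) τ)
  rw [← ENNReal.ofReal_pos, h.ofReal_minTime ha, firstExplosion, ← hj]
  exact hle j

/-- It is enough that one of the last colours, here the one with index `a`, explodes early. -/
lemma Explosive.minLaw_Iio_pos (hF : Explosive F) (x₀ : ℕ) (ha : a < A) {ε : ℝ} (hε : 0 < ε) :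
    0 < minLaw A F x₀ a (Iio ε) := by
  rw [minLaw, Measure.map_apply (measurable_minTime x₀ a) measurableSet_Iio]
  have h1 := hF.explosionCDF_pos x₀ (half_pos hε)
  have h2 : 0 < expFamily F {ρ | tailTime x₀ ρ ≤ ENNReal.ofReal (ε / 2)} :=
    (ENNReal.toReal_pos_iff.1 h1).1
  rw [← (measurePreserving_row F (⟨a, ha⟩ : Fin A)).measure_preimage
    (measurableSet_tailTime_le _ _).nullMeasurableSet] at h2
  refine h2.trans_le (measure_mono_ae ?_)
  filter_upwards [hF.ae_generic x₀] with τ h hτ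
  have hτ' : tailTime x₀ (row ⟨a, ha⟩ τ) ≤ ENNReal.ofReal (ε / 2) := hτ
  rw [← explosionTime_eq_tailTime] at hτ'
  have h3 : firstExplosion (fun _ => x₀) a τ ≤ explosionTime (fun _ => x₀) (⟨a, ha⟩ : Fin A) τ :=
    iInf_le (fun j : {j : Fin A // a ≤ (j : ℕ)} => explosionTime (fun _ => x₀) (j : Fin A) τ)
      ⟨⟨a, ha⟩, le_rfl⟩
  have h4 := h3.trans hτ'
  rw [← h.ofReal_minTime ha, ENNReal.ofReal_le_ofReal_iff (half_pos hε).le] at h4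
  show minTime (fun _ => x₀) a τ < ε
  linarith

/-- Given the explosion time of the last colours, the first `a` colours are independent. -/
lemma Explosive.clockLaw_real_losers (hF : Explosive F) {x₀ x : ℕ} (hx : x₀ ≤ x) (ha : a < A)
    (I : Finset (Fin A)) :
    (clockLaw fun _ : Fin A => F).real {τ | ∀ i ∈ first A a,
        firstExplosion (fun _ => x₀) a τ < explosionTime (fun _ => x₀) i τ ∧
          (i ∈ I → partialTime (fun _ => x₀) i x τ ≤ firstExplosion (fun _ => x₀) a τ)} =
      ∫ s, ∏ i ∈ first A a, (if i ∈ I then passProb F x₀ x s else tailSurvival F x₀ s)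
        ∂minLaw A F x₀ a := by
  let B : Fin A → Set ((ℕ → ℝ) × ℝ≥0∞) := fun i =>
    {z | z.2 < tailTime x₀ z.1 ∧ (i ∈ I → headTime x₀ x z.1 ≤ z.2)}
  have hB : ∀ i, MeasurableSet (B i) := by
    intro i
    have h1 : MeasurableSet {z : (ℕ → ℝ) × ℝ≥0∞ | z.2 < tailTime x₀ z.1} :=
      measurableSet_lt measurable_snd ((measurable_tailTime x₀).comp measurable_fst)
    have h2 : MeasurableSet {z : (ℕ → ℝ) × ℝ≥0∞ | headTime x₀ x z.1 ≤ z.2} :=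
      measurableSet_le ((measurable_headTime x₀ x).comp measurable_fst) measurable_snd
    by_cases hi : i ∈ I
    · simp only [B, hi, forall_true_left]
      exact h1.inter h2
    · simpa only [B, hi, IsEmpty.forall_iff, and_true] using h1
  let g : ({j : Fin A // ¬ (j : ℕ) < a} → ℕ → ℝ) → ℝ≥0∞ := fun w => ⨅ j, tailTime x₀ (w j)
  have hg : Measurable g :=
    Measurable.iInf fun j => (measurable_tailTime x₀).comp (measurable_pi_apply j)
  have hgmin : ∀ τ : Fin A × ℕ → ℝ, firstExplosion (fun _ => x₀) a τ = g fun j => row j τ := by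
    intro τ
    refine (Equiv.subtypeEquivRight fun j : Fin A =>
      (not_lt (a := (j : ℕ)) (b := a)).symm).iInf_congr fun j => ?_
    rw [explosionTime_eq_tailTime]
    rfl
  have hrest : Measurable fun (v : Fin A → ℕ → ℝ) (j : {j : Fin A // ¬ (j : ℕ) < a}) => v j :=
    measurable_pi_lambda _ fun j => measurable_pi_apply _
  have hC : MeasurableSet
      {v : Fin A → ℕ → ℝ | ∀ i : Fin A, (i : ℕ) < a → (v i, g fun j => v j) ∈ B i} := by
    have : {v : Fin A → ℕ → ℝ | ∀ i : Fin A, (i : ℕ) < a → (v i, g fun j => v j) ∈ B i} =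
        ⋂ i : Fin A, ⋂ _ : (i : ℕ) < a,
          (fun v : Fin A → ℕ → ℝ => (v i, g fun j => v j)) ⁻¹' B i := by
      ext; simp
    rw [this]
    exact .iInter fun i => .iInter fun _ =>
      ((measurable_pi_apply i).prodMk (hg.comp hrest)) (hB i)
  have hev : {τ : Fin A × ℕ → ℝ | ∀ i ∈ first A a,
        firstExplosion (fun _ => x₀) a τ < explosionTime (fun _ => x₀) i τ ∧
          (i ∈ I → partialTime (fun _ => x₀) i x τ ≤ firstExplosion (fun _ => x₀) a τ)} =
      (fun τ i => row i τ) ⁻¹'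
        {v | ∀ i : Fin A, (i : ℕ) < a → (v i, g fun j => v j) ∈ B i} := by
    ext τ
    simp only [mem_ofPred_eq, mem_preimage, B, mem_first, ← hgmin, explosionTime_eq_tailTime,
      partialTime_eq_headTime]
  have hf : Measurable fun v : Fin A → ℕ → ℝ =>
      ∏ i ∈ first A a, expFamily F {ρ | (ρ, g fun j => v j) ∈ B i} :=
    Finset.measurable_fun_prod _ fun i _ =>
      (measurable_measure_prodMk_right (hB i)).comp (hg.comp hrest)
  have hint : Measurable fun s : ℝ =>
      ∏ i ∈ first A a, (if i ∈ I then passProb F x₀ x s else tailSurvival F x₀ s) := by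
    refine Finset.measurable_fun_prod _ fun i _ => ?_
    have h1 : Measurable (passProb F x₀ x) := measurable_passProb F hx
    have h2 := measurable_tailSurvival F x₀
    split_ifs <;> assumption
  have h0 : ∀ s : ℝ, 0 ≤ ∏ i ∈ first A a,
      (if i ∈ I then passProb F x₀ x s else tailSurvival F x₀ s) := fun s =>
    Finset.prod_nonneg fun i _ => by split_ifs <;> exact measureReal_nonneg
  have hpi : Measure.pi (fun _ : Fin A => expFamily F)
      {v | ∀ i : Fin A, (i : ℕ) < a → (v i, g fun j => v j) ∈ B i} =
      ∫⁻ v, ∏ i ∈ first A a, expFamily F {ρ | (ρ, g fun j => v j) ∈ B i}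
        ∂Measure.pi (fun _ : Fin A => expFamily F) :=
    pi_forall_mem_eq_lintegral (ι := Fin A) (expFamily F)
    (fun i : Fin A => (i : ℕ) < a) hg hB
  rw [measureReal_def, hev, (measurePreserving_rows F).measure_preimage hC.nullMeasurableSet, hpi,
    ← (measurePreserving_rows F).lintegral_comp hf, minLaw,
    integral_map (measurable_minTime x₀ a).aemeasurable hint.aestronglyMeasurable,
    integral_eq_lintegral_of_nonneg_ae (ae_of_all _ fun τ => h0 _)
      (hint.comp (measurable_minTime x₀ a)).aestronglyMeasurable]
  congr 1
  refine lintegral_congr_ae ?_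
  filter_upwards [hF.ae_generic x₀] with τ h
  rw [← hgmin, ← h.ofReal_minTime ha, ENNReal.ofReal_prod_of_nonneg fun i _ => by
    split_ifs <;> exact measureReal_nonneg]
  refine Finset.prod_congr rfl fun i _ => ?_
  by_cases hi : i ∈ I
  · rw [if_pos hi, passProb, ofReal_measureReal]
    congr 1
    ext ρ
    simp [B, hi, and_comm]
  · rw [if_neg hi, tailSurvival, ofReal_measureReal]
    congr 1
    ext ρ
    simp [B, hi]

end Rows

/-! ### The urn -/

section Urn

variable {A : ℕ} {F : Feedback} {x₀ a : ℕ} {Ω : Type*} [MeasurableSpace Ω] {P : Measure Ω}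
  {X : ℕ → Ω → Fin A → ℕ}

lemma measurableSet_sMon_path (i : Fin A) :
    MeasurableSet {w : ℕ → Fin A → ℕ | ∃ N, ∀ n ≥ N, ∀ j ≠ i, w n j = w N j} := by
  have : {w : ℕ → Fin A → ℕ | ∃ N, ∀ n ≥ N, ∀ j ≠ i, w n j = w N j} =
      ⋃ N : ℕ, ⋂ n : ℕ, ⋂ _ : n ≥ N, ⋂ j : Fin A, ⋂ _ : j ≠ i,
        {w : ℕ → Fin A → ℕ | w n j = w N j} := by
    ext; simp
  rw [this]
  refine .iUnion fun N => .iInter fun n => .iInter fun _ => .iInter fun j => .iInter fun _ => ?_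
  exact measurableSet_eq_fun (by fun_prop) (by fun_prop)

lemma measurableSet_losers_path (a : ℕ) :
    MeasurableSet (losers (fun n (w : ℕ → Fin A → ℕ) => w n) a) := by
  have : losers (fun n (w : ℕ → Fin A → ℕ) => w n) a =
      ⋂ i ∈ first A a, {w : ℕ → Fin A → ℕ | ∃ N, ∀ n ≥ N, ∀ j ≠ i, w n j = w N j}ᶜ := by
    ext; simp [losers, sMon]
  rw [this]
  exact Finset.measurableSet_biInter _ fun i _ => (measurableSet_sMon_path i).compl

lemma measurableSet_final_path (i : Fin A) (x : ℕ) :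
    MeasurableSet {w : ℕ → Fin A → ℕ | (x : ℕ∞) < final (fun n w => w n) i w} := by
  have : {w : ℕ → Fin A → ℕ | (x : ℕ∞) < final (fun n w => w n) i w} =
      ⋃ n, {w : ℕ → Fin A → ℕ | x < w n i} := by
    ext; simp [final, lt_iSup_iff]
  rw [this]
  exact .iUnion fun n => measurableSet_lt measurable_const (by fun_prop)

/-- Losers of the urn and their final number of balls in terms of the explosion times. -/
lemma IsUrn.real_losers_inter [IsProbabilityMeasure P] (hF : Explosive F)
    (hX : IsUrn (fun _ => F) (fun _ => x₀) X P) {x : ℕ} (hx : x₀ ≤ x) (ha : a < A)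
    (I : Finset (Fin A)) (hI : I ⊆ first A a) :
    P.real (losers X a ∩ {ω | ∀ i ∈ I, (x : ℕ∞) < final X i ω}) =
      ∫ s, ∏ i ∈ first A a, (if i ∈ I then passProb F x₀ x s else tailSurvival F x₀ s)
        ∂minLaw A F x₀ a := by
  have : NeZero A := ⟨by omega⟩
  let W : Set (ℕ → Fin A → ℕ) := losers (fun n w => w n) a ∩
    {w | ∀ i ∈ I, (x : ℕ∞) < final (fun n w => w n) i w}
  have hW : MeasurableSet W := by
    refine (measurableSet_losers_path a).inter ?_
    have : {w : ℕ → Fin A → ℕ | ∀ i ∈ I, (x : ℕ∞) < final (fun n w => w n) i w} =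
        ⋂ i ∈ I, {w : ℕ → Fin A → ℕ | (x : ℕ∞) < final (fun n w => w n) i w} := by
      ext; simp
    rw [this]
    exact Finset.measurableSet_biInter _ fun i _ => measurableSet_final_path i x
  have hY := isUrn_embedded (fun _ : Fin A => F) fun _ => x₀
  -- The event depends only on the path, whose law is that of the embedded urn.
  have h1 : P (losers X a ∩ {ω | ∀ i ∈ I, (x : ℕ∞) < final X i ω}) =
      clockLaw (fun _ : Fin A => F) ((fun τ n => embedded n (fun _ => x₀) τ) ⁻¹' W) := by
    rw [← Measure.map_apply hY.measurable_path hW, ← hX.map_path_eq hY,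
      Measure.map_apply hX.measurable_path hW]
    rfl
  rw [← hF.clockLaw_real_losers hx ha I, measureReal_def, h1, measureReal_def]
  congr 1
  refine measure_congr ?_
  filter_upwards [hF.ae_generic x₀] with τ h
  refine propext ⟨fun hτ i hi => ?_, fun hτ => ?_⟩
  · obtain ⟨hl, hf⟩ := hτ
    have hl' : τ ∈ losers (fun n => embedded n fun _ => x₀) a := hl
    exact ⟨h.losers_iff.1 hl' i hi, fun hiI => (h.final_iff hl' hi hx).1 (hf i hiI)⟩
  · have hl : τ ∈ losers (fun n => embedded n fun _ => x₀) a :=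
      h.losers_iff.2 fun i hi => (hτ i hi).1
    exact ⟨hl, fun i hi => (h.final_iff hl (hI hi) hx).2 ((hτ i (hI hi)).2 hi)⟩

lemma card_first (ha : a < A) : (first A a).card = a := by
  have : first A a = Finset.Iio (⟨a, ha⟩ : Fin A) := by
    ext i; simp [first, Fin.lt_def]
  rw [this, Fin.card_Iio]

lemma prod_ite_mem_first (ha : a < A) {I : Finset (Fin A)} (hI : I ⊆ first A a) (u v : ℝ) :
    ∏ i ∈ first A a, (if i ∈ I then u else v) = u ^ I.card * v ^ (a - I.card) := by
  rw [Finset.prod_ite, Finset.prod_const, Finset.prod_const, Finset.filter_mem_eq_inter,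
    Finset.inter_eq_right.2 hI, Finset.filter_notMem_eq_sdiff, Finset.card_sdiff_of_subset hI,
    card_first ha]

/-- Strict Hölder inequality for the probabilities of passing the level `x`. -/
lemma Explosive.passProb_holder (hF : Explosive F) {x : ℕ} (hx : x₀ ≤ x) (ha2 : 2 ≤ a)
    (ha : a < A) :
    0 < ∫ s, tailSurvival F x₀ s ^ a ∂minLaw A F x₀ a ∧
    (∫ s, passProb F x₀ x s * tailSurvival F x₀ s ^ (a - 1) ∂minLaw A F x₀ a) ^ a <
      (∫ s, passProb F x₀ x s ^ a ∂minLaw A F x₀ a) *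
        (∫ s, tailSurvival F x₀ s ^ a ∂minLaw A F x₀ a) ^ (a - 1) := by
  have hlim : Tendsto (passProb F x₀ x) (𝓝[>] 0) (𝓝 0) := by
    have h1 : Tendsto (fun t : ℝ => 1 - Real.exp (-(F x₀ * t))) (𝓝[>] 0) (𝓝 0) := by
      have : Continuous fun t : ℝ => 1 - Real.exp (-(F x₀ * t)) := by fun_prop
      simpa using (this.tendsto 0).mono_left (nhdsWithin_le_nhds (s := Ioi 0))
    refine tendsto_of_tendsto_of_tendsto_of_le_of_le' tendsto_const_nhds h1
      (Eventually.of_forall fun t => measureReal_nonneg) ?_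
    filter_upwards [self_mem_nhdsWithin] with t ht
    exact passProb_le F hx (le_of_lt ht)
  have h := strict_holder (measurable_tailSurvival F x₀) (measurable_passProb F hx)
    (hF.minLaw_pos x₀ ha) (fun ε hε => hF.minLaw_Iio_pos x₀ ha hε)
    (fun s hs => tailSurvival_pos F x₀ (le_of_lt hs)) (fun s _ => tailSurvival_le_one F x₀ s)
    (fun s hs => hF.passProb_pos hx hs) (C := 1) (fun s _ => measureReal_le_one) hlim
    (tendsto_tailSurvival F x₀) ha2
  exact ⟨h.1, h.2.2⟩

/-- The density of the explosion time. -/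
noncomputable def explosionPDF (F : Feedback) (m : ℕ) (t : ℝ) : ℝ :=
  F m * (explosionCDF F (m + 1) t - explosionCDF F m t)

/-- Strict Hölder inequality for the density of the explosion time. -/
lemma Explosive.explosionPDF_holder (hF : Explosive F) (x₀ : ℕ) (ha2 : 2 ≤ a) (ha : a < A) :
    0 < ∫ s, explosionPDF F x₀ s * tailSurvival F x₀ s ^ (a - 1) ∂minLaw A F x₀ a ∧
    (∫ s, explosionPDF F x₀ s * tailSurvival F x₀ s ^ (a - 1) ∂minLaw A F x₀ a) ^ a <
      (∫ s, explosionPDF F x₀ s ^ a ∂minLaw A F x₀ a) *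
        (∫ s, tailSurvival F x₀ s ^ a ∂minLaw A F x₀ a) ^ (a - 1) := by
  have hcont : Continuous (explosionPDF F x₀) :=
    ((continuous_explosionCDF F (x₀ + 1)).sub (continuous_explosionCDF F x₀)).const_mul _
  have hlim : Tendsto (explosionPDF F x₀) (𝓝[>] 0) (𝓝 0) := by
    have h := hcont.tendsto 0
    rw [explosionPDF, explosionCDF_of_nonpos F _ le_rfl, explosionCDF_of_nonpos F _ le_rfl,
      sub_zero, mul_zero] at h
    exact h.mono_left nhdsWithin_le_nhds
  have h := strict_holder (measurable_tailSurvival F x₀) hcont.measurable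
    (hF.minLaw_pos x₀ ha) (fun ε hε => hF.minLaw_Iio_pos x₀ ha hε)
    (fun s hs => tailSurvival_pos F x₀ (le_of_lt hs)) (fun s _ => tailSurvival_le_one F x₀ s)
    (fun s hs => mul_pos (F x₀).2 (sub_pos.2 (hF.explosionCDF_lt_succ x₀ hs))) (C := F x₀)
    (fun s _ => by
      have h1 := explosionCDF_le_one F (x₀ + 1) s
      have h2 := explosionCDF_nonneg F x₀ s
      exact mul_le_of_le_one_right (le_of_lt (F x₀).2) (by linarith)) hlim
    (tendsto_tailSurvival F x₀) ha2
  exact h.2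

lemma density_eq (F : Feedback) (x₀ : ℕ) (i : Fin A) {t : ℝ} (ht : 0 < t) :
    density (fun _ => F) (fun _ => x₀) i t = explosionPDF F x₀ t := by
  have h : (fun u : ℝ => (clockLaw fun _ : Fin A => F).real
      {τ | explosionTime (fun _ => x₀) i τ ≤ ENNReal.ofReal u}) = explosionCDF F x₀ := by
    funext u
    rw [explosionCDF, measureReal_def, measureReal_def,
      ← (measurePreserving_row F i).measure_preimage
        (measurableSet_tailTime_le _ _).nullMeasurableSet]
    simp only [explosionTime_eq_tailTime]
    rfl
  rw [density, h, (hasDerivAt_explosionCDF F x₀ ht).deriv, explosionPDF]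

lemma survival_eq (F : Feedback) (x₀ : ℕ) (i : Fin A) (t : ℝ) :
    survival (fun _ => F) (fun _ => x₀) i t = tailSurvival F x₀ t := by
  rw [survival, tailSurvival, measureReal_def, measureReal_def,
    ← (measurePreserving_row F i).measure_preimage
      (measurableSet_lt measurable_const (measurable_tailTime x₀)).nullMeasurableSet]
  simp only [explosionTime_eq_tailTime]
  rfl

lemma IsUrn.real_losers [IsProbabilityMeasure P] (hF : Explosive F)
    (hX : IsUrn (fun _ => F) (fun _ => x₀) X P) (ha : a < A) :
    P.real (losers X a) = ∫ s, tailSurvival F x₀ s ^ a ∂minLaw A F x₀ a := by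
  have h := hX.real_losers_inter hF (le_refl x₀) ha ∅ (Finset.empty_subset _)
  simpa [card_first ha] using h

/-- In this form `c(A,a) > 1` is literally the strict Hölder inequality. The formula for the density
is needed only at positive times, where the law of `S` lives. -/
lemma Explosive.tailDependence_eq [IsProbabilityMeasure P] (hF : Explosive F)
    (hX : IsUrn (fun _ => F) (fun _ => x₀) X P) (ha : a < A) :
    tailDependence (fun _ => F) (fun _ => x₀) P X a =
      (∫ s, explosionPDF F x₀ s ^ a ∂minLaw A F x₀ a) /
        (∫ s, explosionPDF F x₀ s * tailSurvival F x₀ s ^ (a - 1) ∂minLaw A F x₀ a) ^ a *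
        (∫ s, tailSurvival F x₀ s ^ a ∂minLaw A F x₀ a) ^ (a - 1) := by
  have hpos : ∀ᵐ τ ∂clockLaw (fun _ : Fin A => F), 0 < minTime (fun _ => x₀) a τ :=
    ae_of_ae_map (measurable_minTime x₀ a).aemeasurable (hF.minLaw_pos x₀ ha)
  have hcont : Continuous (explosionPDF F x₀) :=
    ((continuous_explosionCDF F (x₀ + 1)).sub (continuous_explosionCDF F x₀)).const_mul _
  have hG := measurable_tailSurvival F x₀
  have e1 : ∫ τ, ∏ i ∈ first A a, density (fun _ => F) (fun _ => x₀) i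
      (minTime (fun _ => x₀) a τ) ∂clockLaw (fun _ : Fin A => F) =
      ∫ s, explosionPDF F x₀ s ^ a ∂minLaw A F x₀ a := by
    rw [minLaw, integral_map (measurable_minTime x₀ a).aemeasurable
      (hcont.measurable.pow_const a).aestronglyMeasurable]
    refine integral_congr_ae ?_
    filter_upwards [hpos] with τ hτ
    rw [Finset.prod_congr rfl fun i _ => density_eq F x₀ i hτ, Finset.prod_const, card_first ha]
  have e2 : ∀ i ∈ first A a, ∫ τ, (∏ j ∈ (first A a).erase i,
      survival (fun _ => F) (fun _ => x₀) j (minTime (fun _ => x₀) a τ)) *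
        density (fun _ => F) (fun _ => x₀) i (minTime (fun _ => x₀) a τ)
        ∂clockLaw (fun _ : Fin A => F) =
      ∫ s, explosionPDF F x₀ s * tailSurvival F x₀ s ^ (a - 1) ∂minLaw A F x₀ a := by
    intro i hi
    have hm : Measurable fun s => explosionPDF F x₀ s * tailSurvival F x₀ s ^ (a - 1) :=
      hcont.measurable.mul (hG.pow_const _)
    rw [minLaw, integral_map (measurable_minTime x₀ a).aemeasurable hm.aestronglyMeasurable]
    refine integral_congr_ae ?_
    filter_upwards [hpos] with τ hτ
    rw [density_eq F x₀ i hτ, Finset.prod_congr rfl fun j _ => survival_eq F x₀ j _,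
      Finset.prod_const, Finset.card_erase_of_mem hi, card_first ha, mul_comm]
  rw [tailDependence, e1, Finset.prod_congr rfl e2, Finset.prod_const, card_first ha,
    hX.real_losers hF ha]

end Urn

end PolyaUrn

theorem mainTheorem10 {A a : ℕ} (ha : 2 ≤ a) (haA : a < A)
    (F : PolyaUrn.Feedback) (hF : PolyaUrn.Explosive F) (x₀ : ℕ) (hx₀ : 1 ≤ x₀)
    {Ω : Type*} [MeasurableSpace Ω] (P : MeasureTheory.Measure Ω)
    [MeasureTheory.IsProbabilityMeasure P] (X : ℕ → Ω → Fin A → ℕ)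
    (hX : PolyaUrn.IsUrn (fun _ => F) (fun _ => x₀) X P) :
    1 < PolyaUrn.tailDependence (fun _ => F) (fun _ => x₀) P X a ∧
    ∀ x : ℕ, x₀ ≤ x →
      (PolyaUrn.condLosers P X a).real
          {ω | ∀ i ∈ PolyaUrn.first A a, (x : ℕ∞) < PolyaUrn.final X i ω} >
        ∏ i ∈ PolyaUrn.first A a,
          (PolyaUrn.condLosers P X a).real {ω | (x : ℕ∞) < PolyaUrn.final X i ω} := by
  open PolyaUrn in
  constructor
  · obtain ⟨hJ, hlt⟩ := hF.explosionPDF_holder (A := A) x₀ ha haA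
    rw [hF.tailDependence_eq hX haA, div_mul_eq_mul_div, one_lt_div (pow_pos hJ a)]
    exact hlt
  · intro x hx
    obtain ⟨hI, hlt⟩ := hF.passProb_holder (A := A) hx ha haA
    have hmL : MeasurableSet (losers X a) := hX.measurable_path (measurableSet_losers_path a)
    have hcond : ∀ B : Set Ω, (condLosers P X a).real B =
        (∫ s, tailSurvival F x₀ s ^ a ∂minLaw A F x₀ a)⁻¹ * P.real (losers X a ∩ B) := by
      intro B
      rw [condLosers, measureReal_def, cond_apply hmL, ENNReal.toReal_mul, ENNReal.toReal_inv,
        ← hX.real_losers hF haA]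
      rfl
    have hone : ∀ i ∈ first A a, (condLosers P X a).real {ω | (x : ℕ∞) < final X i ω} =
        (∫ s, tailSurvival F x₀ s ^ a ∂minLaw A F x₀ a)⁻¹ *
          ∫ s, passProb F x₀ x s * tailSurvival F x₀ s ^ (a - 1) ∂minLaw A F x₀ a := by
      intro i hi
      have hsub : ({i} : Finset (Fin A)) ⊆ first A a := Finset.singleton_subset_iff.2 hi
      have h := hX.real_losers_inter hF hx haA {i} hsub
      simp only [prod_ite_mem_first haA hsub, Finset.card_singleton, pow_one] at h
      rw [hcond, ← h]
      simp
    have hall := hX.real_losers_inter hF hx haA _ (Finset.Subset.refl (first A a))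
    simp only [prod_ite_mem_first haA (Finset.Subset.refl _), card_first haA, Nat.sub_self,
      pow_zero, mul_one] at hall
    rw [hcond, hall, Finset.prod_congr rfl hone, Finset.prod_const, card_first haA, gt_iff_lt,
      mul_pow, inv_pow, inv_mul_eq_div, inv_mul_eq_div, div_lt_div_iff₀ (pow_pos hI a) hI]
    -- Conditioning divides the joint probability by `P(L_a)` once and the product by `P(L_a) ^ a`;
    -- after cross-multiplication the claim is Hölder's inequality times one further factor
    -- `P(L_a)`.
    calc _ < _ := mul_lt_mul_of_pos_right hlt hI
      _ = _ := by rw [mul_assoc, ← pow_succ, Nat.sub_add_cancel (by omega)]
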